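/- **Setting.** Let $K$ be a field of characteristic $0$. $\mathrm{GW}(K)$ is its Grothendieck–Witt ring (the group completion of the monoid of isometry classes of nondegenerate symmetric bilinear forms on finite-dimensional $K$-vector spaces under $\oplus$, with product $\otimes$), $\langle u\rangle$ is the class of the form $(x,y)\mapsto uxy$ on $K$ for $u\in K^\times$, and $\mathbb H=\langle 1\rangle+\langle -1\rangle$. Fix integers $k\ge 0$, $a\ge 1$, $g\ge 0$, $\ell_r,\ell_l\ge 1$. Let $H$ be the set of all $(\mathbf w^{(r)},\mathbf w^{(l)})\in\mathbb Z_{>0}^{\ell_r}\times\mathbb Z_{>0}^{\ell_l}$ with all entries odd and $\sum_j \mathbf w^{(r)}_j=b$, $\sum_i \mathbf w^{(l)}_i=ak+b$ for some integer $b$ (which varies with the point of $H$). A *floor diagram* $\mathcal D$ is a finite loopless multigraph on $\{1,\dots,a\}$, up to isomorphisms fixing the vertices, with positive integer edge weights, every edge being oriented towards its larger endpoint. It has genus $g$ if it is connected with first Betti number $g$. The divergence $\operatorname{div}(v)$ is the total weight of the incoming edges minus that of the outgoing edges at $v$. A *marking* of $\mathcal D$ of degree $\Delta_k(\mathbf w^{(r)},\mathbf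 w^{(l)},a)$ is obtained by calling the given vertices white and 1. subdividing every edge by a black vertex, both halves keeping weight and orientation; 2. adding for every $i$ a black vertex with an edge of weight $\mathbf w^{(l)}_i$ from it to a white vertex, and for every $j$ a black vertex with an edge of weight $\mathbf w^{(r)}_j$ from a white vertex to it, such that afterwards every white vertex has divergence exactly $k$; 3. extending the order of the white vertices to a total order of all vertices compatible with the orientation of all edges. Two markings are equivalent if there is an isomorphism of the marked weighted graphs fixing the white vertices and preserving the total orders. Let $\nu(\mathcal D)$ be the number of equivalence classes. The arithmetic multiplicity of an edge of weight $w$ is $\frac{w-1}{2}\mathbb H+\langle w\rangle$ if $w$ is odd and $\frac w2\mathbb H$ if $w$ is even, and $\operatorname{mult}_{\mathbb A^1}(\mathcal D)\in \mathrm{GW}(K)$ is the product of the multiplicities of all edges of the marked diagram (thus every edge of $\mathcal D$ counts twice and every end once). Put $$N^{\mathrm{floor}}_{\mathbb A^1}(k,a,g)(\mathbf w^{(r)},\mathbf w^{(l)})=\sum_{\mathcal D}\operatorname{mult}_{\mathbb A^1}(\mathcal D)\,\nu(\mathcal D)\in\mathrm{GW}(K),$$ the sum running over all floor diagrams of genus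 $g$; only finitely many terms are non-zero. **Theorem.** There is a function $M\colon H\to\mathbb Z$ such that for all $(\mathbf w^{(r)},\mathbf w^{(l)})\in H$ $$N^{\mathrm{floor}}_{\mathbb A^1}(k,a,g)(\mathbf w^{(r)},\mathbf w^{(l)})=M(\mathbf w^{(r)},\mathbf w^{(l)})\cdot\mathbb H+\sum_{\mathcal D}\nu(\mathcal D)\,\Big\langle(-1)^{i_{\mathcal D}}\prod_j\mathbf w^{(r)}_j\prod_i\mathbf w^{(l)}_i\Big\rangle$$ for suitable integers $i_{\mathcal D}\ge 0$ (depending also on $(\mathbf w^{(r)},\mathbf w^{(l)})$), the sum running over the floor diagrams $\mathcal D$ of genus $g$ all of whose edge weights are odd. (Comparing ranks, this determines $M$.) The coefficient $M$ is piecewise polynomial in the entries of $\mathbf w^{(r)}$ and $\mathbf w^{(l)}$: there are finitely many affine-linear forms with rational coefficients on $\mathbb Q^{\ell_r+\ell_l}$ such that, on the set of all points of $H$ at which each of these forms has a prescribed sign (negative, zero or positive), $M$ is given by a polynomial with rational coefficients. The same holds if in all sums only those floor diagrams are admitted that satisfy $\operatorname{div}(v)\le k$ at every vertex $v$. -/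

import Mathlib

open scoped TensorProduct

universe u

/-- A quadratic space over `K`: a finite-dimensional `K`-vector space with a nondegenerate
symmetric bilinear form. -/
structure QuadSpace (K : Type u) [Field K] where
  carrier : Type u
  [addCommGroup : AddCommGroup carrier]
  [module : Module K carrier]
  [finiteDimensional : FiniteDimensional K carrier]
  form : LinearMap.BilinForm K carrier
  isSymm : form.IsSymm
  nondegenerate : form.Nondegenerate

namespace QuadSpace

attribute [instance] addCommGroup module finiteDimensional

variable {K : Type u} [Field K]

/-- Two quadratic spaces are isometric if a linear isomorphism carries one form to the other. -/
def Isometric (X Y : QuadSpace K) : Prop :=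
  ∃ e : X.carrier ≃ₗ[K] Y.carrier, ∀ x y, Y.form (e x) (e y) = X.form x y

instance setoid (K : Type u) [Field K] : Setoid (QuadSpace K) where
  r := Isometric
  iseqv :=
    { refl := fun _ => ⟨LinearEquiv.refl K _, fun _ _ => rfl⟩
      symm := fun ⟨e, he⟩ => ⟨e.symm, fun x y => by rw [← he]; simp⟩
      trans := fun ⟨e, he⟩ ⟨f, hf⟩ => ⟨e.trans f, fun x y => by simp [he, hf]⟩ }

/-- The orthogonal direct sum. -/
def directSum (X Y : QuadSpace K) : QuadSpace K where
  carrier := X.carrier × Y.carrier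
  form := X.form.compl₁₂ (LinearMap.fst K _ _) (LinearMap.fst K _ _) +
    Y.form.compl₁₂ (LinearMap.snd K _ _) (LinearMap.snd K _ _)
  isSymm := ⟨fun x y => by simp [X.isSymm.eq x.1 y.1, Y.isSymm.eq x.2 y.2]⟩
  nondegenerate := by
    constructor
    · intro x hx
      refine Prod.ext (X.nondegenerate.1 _ fun y => ?_) (Y.nondegenerate.1 _ fun y => ?_)
      · simpa using hx (y, 0)
      · simpa using hx (0, y)
    · intro x hx
      refine Prod.ext (X.nondegenerate.2 _ fun y => ?_) (Y.nondegenerate.2 _ fun y => ?_)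
      · simpa using hx (y, 0)
      · simpa using hx (0, y)

theorem directSum_form (X Y : QuadSpace K) (x y : X.carrier × Y.carrier) :
    (X.directSum Y).form x y = X.form x.1 y.1 + Y.form x.2 y.2 := rfl

/-- The form `(v ⊗ w, v' ⊗ w') ↦ B v v' * C w w'` on a tensor product. -/
noncomputable def tmulForm {V W : Type*} [AddCommGroup V] [Module K V] [AddCommGroup W] [Module K W]
    (B : LinearMap.BilinForm K V) (C : LinearMap.BilinForm K W) :
    LinearMap.BilinForm K (V ⊗[K] W) :=
  LinearMap.BilinForm.tmul B C

theorem tmulForm_tmul {V W : Type*} [AddCommGroup V] [Module K V] [AddCommGroup W] [Module K W]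
    (B : LinearMap.BilinForm K V) (C : LinearMap.BilinForm K W) (v v' : V) (w w' : W) :
    tmulForm B C (v ⊗ₜ[K] w) (v' ⊗ₜ[K] w') = B v v' * C w w' :=
  mul_comm _ _

theorem isSymm_tmulForm {V W : Type*} [AddCommGroup V] [Module K V] [AddCommGroup W] [Module K W]
    {B : LinearMap.BilinForm K V} {C : LinearMap.BilinForm K W} (hB : B.IsSymm) (hC : C.IsSymm) :
    (tmulForm B C).IsSymm :=
  LinearMap.BilinForm.isSymm_iff.2 (LinearMap.IsSymm.tmul
    (LinearMap.BilinForm.isSymm_iff.1 hB) (LinearMap.BilinForm.isSymm_iff.1 hC))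

/-- The tensor product, with form `(x ⊗ y, x' ⊗ y') ↦ X.form x x' * Y.form y y'`. -/
noncomputable def tensor (X Y : QuadSpace K) : QuadSpace K where
  carrier := X.carrier ⊗[K] Y.carrier
  form := tmulForm X.form Y.form
  isSymm := isSymm_tmulForm X.isSymm Y.isSymm
  nondegenerate := by
    have hs : (tmulForm X.form Y.form).IsSymm := isSymm_tmulForm X.isSymm Y.isSymm
    have key : ∀ x, (∀ y, tmulForm X.form Y.form x y = 0) → x = 0 := by
      intro x hx
      let e : X.carrier ⊗[K] Y.carrier ≃ₗ[K] Module.Dual K (X.carrier ⊗[K] Y.carrier) :=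
        (TensorProduct.congr (X.form.toDual X.nondegenerate) (Y.form.toDual Y.nondegenerate)).trans
          (TensorProduct.dualDistribEquiv K X.carrier Y.carrier)
      have he : e.toLinearMap = tmulForm X.form Y.form := by
        ext a b c d
        exact mul_comm _ _
      have : e x = 0 := by
        ext1
        ext a b
        have := hx (a ⊗ₜ b)
        rw [← he] at this
        exact this
      simpa using this
    exact ⟨key, fun x hx => key x fun y => by rw [← hx y]; exact (hs.eq x y)⟩

/-- The zero space. -/
def zero (K : Type u) [Field K] : QuadSpace K where
  carrier := PUnit.{u + 1}
  form := 0
  isSymm := ⟨fun _ _ => by simp⟩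
  nondegenerate := ⟨fun _ _ => rfl, fun _ _ => rfl⟩

/-- The one-dimensional quadratic space `⟨a⟩`, i.e. `K` with the form `(x, y) ↦ a * x * y`. -/
def line (a : Kˣ) : QuadSpace K where
  carrier := K
  form := (a : K) • LinearMap.mul K K
  isSymm := ⟨fun x y => by simp [mul_comm]⟩
  nondegenerate :=
    ⟨fun x hx => by simpa using hx 1, fun x hx => by simpa using hx 1⟩

theorem line_form (a : Kˣ) (x y : K) : (line a).form x y = a * (x * y) := rfl

theorem tmul_isometry {V W U : Type*} [AddCommGroup V] [Module K V] [AddCommGroup W] [Module K W]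
    [AddCommGroup U] [Module K U] (B : LinearMap.BilinForm K V) (C : LinearMap.BilinForm K W)
    (D : LinearMap.BilinForm K U) (e : V ⊗[K] W →ₗ[K] U)
    (h : ∀ v v' w w', D (e (v ⊗ₜ[K] w)) (e (v' ⊗ₜ[K] w')) = B v v' * C w w') (s t : V ⊗[K] W) :
    D (e s) (e t) = tmulForm B C s t := by
  have : D.compl₁₂ e e = tmulForm B C := by
    ext v w v' w'
    exact (h v v' w w').trans (mul_comm _ _)
  exact LinearMap.congr_fun₂ this s t

theorem tmul_assoc_isometry {V W U : Type*} [AddCommGroup V] [Module K V] [AddCommGroup W]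
    [Module K W] [AddCommGroup U] [Module K U] (B : LinearMap.BilinForm K V)
    (C : LinearMap.BilinForm K W) (D : LinearMap.BilinForm K U) (s t : (V ⊗[K] W) ⊗[K] U) :
    tmulForm B (tmulForm C D) (TensorProduct.assoc K V W U s) (TensorProduct.assoc K V W U t) =
      tmulForm (tmulForm B C) D s t := by
  have : (tmulForm B (tmulForm C D)).compl₁₂ (TensorProduct.assoc K V W U).toLinearMap
      (TensorProduct.assoc K V W U).toLinearMap = tmulForm (tmulForm B C) D := by
    ext v w u v' w' u'
    exact mul_assoc (D u u') (C w w') (B v v')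
  exact LinearMap.congr_fun₂ this s t

theorem directSum_congr {X X' Y Y' : QuadSpace K} (h : Isometric X X') (h' : Isometric Y Y') :
    Isometric (X.directSum Y) (X'.directSum Y') := by
  obtain ⟨e, he⟩ := h
  obtain ⟨f, hf⟩ := h'
  exact ⟨e.prodCongr f, fun x y => congrArg₂ (· + ·) (he x.1 y.1) (hf x.2 y.2)⟩

theorem tensor_congr {X X' Y Y' : QuadSpace K} (h : Isometric X X') (h' : Isometric Y Y') :
    Isometric (X.tensor Y) (X'.tensor Y') := by
  obtain ⟨e, he⟩ := h
  obtain ⟨f, hf⟩ := h'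
  refine ⟨TensorProduct.congr e f, tmul_isometry X.form Y.form (tmulForm X'.form Y'.form)
    (TensorProduct.congr e f).toLinearMap fun x x' y y' => ?_⟩
  rw [← he, ← hf]
  exact mul_comm _ _

theorem directSum_comm (X Y : QuadSpace K) : Isometric (X.directSum Y) (Y.directSum X) :=
  ⟨LinearEquiv.prodComm K _ _, fun _ _ => add_comm _ _⟩

theorem directSum_assoc (X Y Z : QuadSpace K) :
    Isometric ((X.directSum Y).directSum Z) (X.directSum (Y.directSum Z)) :=
  ⟨LinearEquiv.prodAssoc K _ _ _, fun _ _ => (add_assoc _ _ _).symm⟩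

theorem zero_directSum (X : QuadSpace K) : Isometric ((zero K).directSum X) X :=
  ⟨LinearEquiv.uniqueProd (M₂ := PUnit.{u + 1}), fun _ _ => (zero_add _).symm⟩

theorem tensor_comm (X Y : QuadSpace K) : Isometric (X.tensor Y) (Y.tensor X) :=
  ⟨TensorProduct.comm K X.carrier Y.carrier, tmul_isometry X.form Y.form (tmulForm Y.form X.form)
    (TensorProduct.comm K X.carrier Y.carrier).toLinearMap fun _ _ _ _ => rfl⟩

theorem one_tensor (X : QuadSpace K) : Isometric ((line 1).tensor X) X :=
  ⟨TensorProduct.lid K X.carrier, tmul_isometry (line (1 : Kˣ)).form X.form X.form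
    (TensorProduct.lid K X.carrier).toLinearMap fun (x x' : K) y y' => by
      change X.form (x • y) (x' • y') = (((1 : Kˣ) : K) * (x * x')) * X.form y y'
      simp only [map_smul, LinearMap.smul_apply, smul_eq_mul, Units.val_one]
      ring⟩

theorem zero_tensor (X : QuadSpace K) : Isometric ((zero K).tensor X) (zero K) := by
  have : Subsingleton (PUnit.{u + 1} ⊗[K] X.carrier) := inferInstance
  refine ⟨(0 : PUnit.{u + 1} ⊗[K] X.carrier ≃ₗ[K] PUnit.{u + 1}), fun x y => ?_⟩
  have hx : x = 0 := Subsingleton.elim (α := PUnit.{u + 1} ⊗[K] X.carrier) x 0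
  subst hx
  exact (LinearMap.congr_fun (map_zero ((zero K).tensor X).form) y).symm

theorem tensor_directSum (X Y Z : QuadSpace K) :
    Isometric (X.tensor (Y.directSum Z)) ((X.tensor Y).directSum (X.tensor Z)) :=
  ⟨TensorProduct.prodRight K K X.carrier Y.carrier Z.carrier,
    tmul_isometry X.form (Y.directSum Z).form ((X.tensor Y).directSum (X.tensor Z)).form
      (TensorProduct.prodRight K K X.carrier Y.carrier Z.carrier).toLinearMap fun x x' y y' => by
        exact (congrArg₂ (· + ·) (mul_comm _ _) (mul_comm _ _)).trans (mul_add _ _ _).symm⟩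

theorem tensor_assoc (X Y Z : QuadSpace K) :
    Isometric ((X.tensor Y).tensor Z) (X.tensor (Y.tensor Z)) :=
  ⟨TensorProduct.assoc K X.carrier Y.carrier Z.carrier,
    tmul_assoc_isometry X.form Y.form Z.form⟩

end QuadSpace

/-- The isometry classes of quadratic spaces over `K`. -/
def QuadClass (K : Type u) [Field K] : Type (u + 1) := Quotient (QuadSpace.setoid K)

namespace QuadClass

variable {K : Type u} [Field K]

/-- The isometry class of a quadratic space. -/
def mk (X : QuadSpace K) : QuadClass K := Quotient.mk (QuadSpace.setoid K) X

/-- Addition of isometry classes is the orthogonal direct sum. -/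
noncomputable instance : Add (QuadClass K) :=
  ⟨Quotient.map₂ QuadSpace.directSum fun _ _ h _ _ h' => QuadSpace.directSum_congr h h'⟩

/-- Multiplication of isometry classes is the tensor product. -/
noncomputable instance : Mul (QuadClass K) :=
  ⟨Quotient.map₂ QuadSpace.tensor fun _ _ h _ _ h' => QuadSpace.tensor_congr h h'⟩

noncomputable instance : Zero (QuadClass K) := ⟨mk (QuadSpace.zero K)⟩

noncomputable instance : One (QuadClass K) := ⟨mk (QuadSpace.line 1)⟩

noncomputable instance : CommSemiring (QuadClass K) where
  nsmul := nsmulRec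
  add_assoc := by rintro ⟨X⟩ ⟨Y⟩ ⟨Z⟩; exact Quotient.sound (QuadSpace.directSum_assoc X Y Z)
  add_comm := by rintro ⟨X⟩ ⟨Y⟩; exact Quotient.sound (QuadSpace.directSum_comm X Y)
  zero_add := by rintro ⟨X⟩; exact Quotient.sound (QuadSpace.zero_directSum X)
  add_zero := by
    rintro ⟨X⟩
    exact Quotient.sound
      ((QuadSpace.setoid K).trans (QuadSpace.directSum_comm _ _) (QuadSpace.zero_directSum X))
  mul_assoc := by rintro ⟨X⟩ ⟨Y⟩ ⟨Z⟩; exact Quotient.sound (QuadSpace.tensor_assoc X Y Z)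
  mul_comm := by rintro ⟨X⟩ ⟨Y⟩; exact Quotient.sound (QuadSpace.tensor_comm X Y)
  one_mul := by rintro ⟨X⟩; exact Quotient.sound (QuadSpace.one_tensor X)
  mul_one := by
    rintro ⟨X⟩
    exact Quotient.sound
      ((QuadSpace.setoid K).trans (QuadSpace.tensor_comm _ _) (QuadSpace.one_tensor X))
  zero_mul := by rintro ⟨X⟩; exact Quotient.sound (QuadSpace.zero_tensor X)
  mul_zero := by
    rintro ⟨X⟩
    exact Quotient.sound
      ((QuadSpace.setoid K).trans (QuadSpace.tensor_comm _ _) (QuadSpace.zero_tensor X))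
  left_distrib := by
    rintro ⟨X⟩ ⟨Y⟩ ⟨Z⟩; exact Quotient.sound (QuadSpace.tensor_directSum X Y Z)
  right_distrib := by
    rintro ⟨X⟩ ⟨Y⟩ ⟨Z⟩
    exact Quotient.sound ((QuadSpace.setoid K).trans (QuadSpace.tensor_comm _ _)
      ((QuadSpace.setoid K).trans (QuadSpace.tensor_directSum Z X Y)
        (QuadSpace.directSum_congr (QuadSpace.tensor_comm _ _) (QuadSpace.tensor_comm _ _))))

end QuadClass

/-- The Grothendieck-Witt ring of `K`: the group completion of the monoid of isometry classes of
quadratic spaces under orthogonal sum, with the multiplication induced by the tensor product. -/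
def GW (K : Type u) [Field K] : Type (u + 1) := Algebra.GrothendieckAddGroup (QuadClass K)

namespace GW

variable {K : Type u} [Field K]

noncomputable instance : AddCommGroup (GW K) :=
  inferInstanceAs (AddCommGroup (Algebra.GrothendieckAddGroup (QuadClass K)))

/-- The class in `GW K` of an isometry class. -/
noncomputable def ofClass : QuadClass K →+ GW K := Algebra.GrothendieckAddGroup.of

theorem hom_ext {G : Type*} [AddCommGroup G] {f g : GW K →+ G}
    (h : ∀ x, f (ofClass x) = g (ofClass x)) : f = g :=
  Algebra.GrothendieckAddGroup.lift.symm.injective (AddMonoidHom.ext h)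

/-- Extension of additive maps from isometry classes to `GW K`. -/
noncomputable def lift {G : Type*} [AddCommGroup G] (f : QuadClass K →+ G) : GW K →+ G :=
  Algebra.GrothendieckAddGroup.lift f

@[simp]
theorem lift_ofClass {G : Type*} [AddCommGroup G] (f : QuadClass K →+ G) (x : QuadClass K) :
    lift f (ofClass x) = f x :=
  DFunLike.congr_fun (Algebra.GrothendieckAddGroup.lift.symm_apply_apply f) x

/-- The biadditive extension of the tensor product to `GW K`. -/
noncomputable def mulHom : GW K →+ GW K →+ GW K :=
  lift
    { toFun := fun x => lift (ofClass.comp (AddMonoidHom.mulLeft x))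
      map_zero' := hom_ext fun y => by simp
      map_add' := fun x x' => hom_ext fun y => by simp [add_mul] }

theorem mulHom_ofClass (x y : QuadClass K) :
    mulHom (ofClass x) (ofClass y) = ofClass (x * y) := by
  simp [mulHom]

noncomputable instance : Mul (GW K) := ⟨fun x y => mulHom x y⟩

noncomputable instance : One (GW K) := ⟨ofClass 1⟩

theorem mul_def (x y : GW K) : x * y = mulHom x y := rfl

theorem ofClass_mul (x y : QuadClass K) : ofClass (x * y) = ofClass x * ofClass y :=
  (mulHom_ofClass x y).symm

protected theorem mul_comm (x y : GW K) : x * y = y * x := by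
  have : mulHom (K := K) = mulHom.flip :=
    hom_ext fun x => hom_ext fun y => by simp [mulHom_ofClass, mul_comm]
  exact DFunLike.congr_fun (DFunLike.congr_fun this x) y

protected theorem mul_assoc (x y z : GW K) : x * y * z = x * (y * z) := by
  have h₁ : ∀ (a b : QuadClass K) (z : GW K),
      mulHom (mulHom (ofClass a) (ofClass b)) z = mulHom (ofClass a) (mulHom (ofClass b) z) := by
    intro a b z
    have : mulHom (mulHom (ofClass a) (ofClass b)) = (mulHom (ofClass a)).comp (mulHom (ofClass b)) :=
      hom_ext fun c => by simp [mulHom_ofClass, mul_assoc]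
    exact DFunLike.congr_fun this z
  have h₂ : ∀ (a : QuadClass K) (y z : GW K),
      mulHom (mulHom (ofClass a) y) z = mulHom (ofClass a) (mulHom y z) := by
    intro a y z
    have : (mulHom.flip z).comp (mulHom (ofClass a)) =
        (mulHom (ofClass a)).comp (mulHom.flip z) := hom_ext fun b => h₁ a b z
    exact DFunLike.congr_fun this y
  have h₃ : (mulHom.flip z).comp (mulHom.flip y) = mulHom.flip (mulHom y z) :=
    hom_ext fun a => h₂ a y z
  exact DFunLike.congr_fun h₃ x

protected theorem one_mul (x : GW K) : 1 * x = x := by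
  have : mulHom (1 : GW K) = AddMonoidHom.id _ := hom_ext fun y => by
    change mulHom (ofClass 1) (ofClass y) = _
    simp [mulHom_ofClass]
  exact DFunLike.congr_fun this x

noncomputable instance : CommRing (GW K) where
  __ := (inferInstance : AddCommGroup (GW K))
  mul_assoc := GW.mul_assoc
  mul_comm := GW.mul_comm
  one_mul := GW.one_mul
  mul_one x := by rw [GW.mul_comm, GW.one_mul]
  left_distrib x y z := map_add (mulHom x) y z
  right_distrib x y z := by rw [mul_def, map_add]; rfl
  zero_mul x := by rw [mul_def, map_zero]; rfl
  mul_zero x := map_zero (mulHom x)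

/-- The class `⟨a⟩` of the one-dimensional form `(x, y) ↦ a * x * y`. -/
noncomputable def unitForm (a : Kˣ) : GW K := ofClass (QuadClass.mk (QuadSpace.line a))

/-- The class of the hyperbolic plane, `⟨1⟩ + ⟨-1⟩`. -/
noncomputable def hyperbolic (K : Type u) [Field K] : GW K := unitForm 1 + unitForm (-1)

end GW

/-! ### Floor diagrams

A floor diagram is a finite loopless multigraph on the totally ordered set of vertices `Fin a`, with
positive integer edge weights, considered up to isomorphisms that fix the vertices. Every edge is
oriented towards its larger endpoint, so that such a diagram is a multiset of weighted edges. -/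

/-- A weighted edge between two vertices of `Fin a`, oriented towards the larger one. -/
@[ext]
structure FloorEdge (a : ℕ) where
  src : Fin a
  tgt : Fin a
  src_lt_tgt : src < tgt
  weight : ℕ+
  deriving DecidableEq

/-- A floor diagram on the vertex set `Fin a`. -/
@[ext]
structure FloorDiagram (a : ℕ) where
  edges : Multiset (FloorEdge a)

/-- The weights of `lr` right ends (indexed by `Sum.inl`) and `ll` left ends (`Sum.inr`). -/
abbrev EndWeights (lr ll : ℕ) : Type := Fin lr ⊕ Fin ll → ℕ+

/-- The set of pairs of tuples `(w^r, w^l)` with odd entries such that, for some `b`, the entries of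
`w^r` sum to `b` and the entries of `w^l` sum to `a * k + b`. -/
def oddEndWeights (k a lr ll : ℕ) : Set (EndWeights lr ll) :=
  {w | (∀ x, Odd (w x : ℕ)) ∧ ∃ b : ℕ, ∑ j, (w (Sum.inl j) : ℕ) = b ∧
    ∑ i, (w (Sum.inr i) : ℕ) = a * k + b}

namespace FloorDiagram

variable {a : ℕ} (D : FloorDiagram a)

/-- The divergence at `v`: total weight of the incoming minus total weight of the outgoing edges. -/
def div (v : Fin a) : ℤ :=
  ((D.edges.filter fun e => e.tgt = v).map fun e => ((e.weight : ℕ) : ℤ)).sum -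
    ((D.edges.filter fun e => e.src = v).map fun e => ((e.weight : ℕ) : ℤ)).sum

/-- The simple graph obtained by forgetting weights and multiplicities of edges. -/
def graph : SimpleGraph (Fin a) :=
  SimpleGraph.fromRel fun u v => ∃ e ∈ D.edges, e.src = u ∧ e.tgt = v

/-- The genus (first Betti number) of a connected floor diagram. -/
def genus : ℤ := (Multiset.card D.edges : ℤ) - a + 1

/-- `D` is connected of genus `g`, and all its divergences are at most `c` (for `c = ⊤` this last
condition is empty). -/
def IsAdmissible (g : ℕ) (c : WithTop ℤ) : Prop :=
  D.graph.Connected ∧ D.genus = g ∧ ∀ v, (D.div v : WithTop ℤ) ≤ c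

/-- All edges of `D` have odd weight. -/
def IsOdd : Prop := ∀ e ∈ D.edges, Odd (e.weight : ℕ)

/-- The vertices of the marked floor diagrams arising from `D`: the white vertices, and the black
vertices, namely one on each edge of `D` and one at the tip of each left end and each right end. -/
inductive MarkedVertex (D : FloorDiagram a) (lr ll : ℕ) : Type
  | white (v : Fin a)
  | edge (e : D.edges.ToType)
  | right (j : Fin lr)
  | left (i : Fin ll)

variable {lr ll : ℕ}

/-- The weighted oriented edges of a marked floor diagram arising from `D`: each edge of `D` is
subdivided into two edges of the same weight, each left end leads from its black vertex to a white
vertex, and each right end leads from a white vertex to its black vertex. -/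
inductive MarkedArc (w : EndWeights lr ll) (rightSrc : Fin lr → Fin a) (leftTgt : Fin ll → Fin a) :
    D.MarkedVertex lr ll → D.MarkedVertex lr ll → ℕ+ → Prop
  | firstHalf (e : D.edges.ToType) : MarkedArc w rightSrc leftTgt (.white e.1.src) (.edge e) e.1.weight
  | secondHalf (e : D.edges.ToType) : MarkedArc w rightSrc leftTgt (.edge e) (.white e.1.tgt) e.1.weight
  | right (j : Fin lr) : MarkedArc w rightSrc leftTgt (.white (rightSrc j)) (.right j) (w (Sum.inl j))
  | left (i : Fin ll) : MarkedArc w rightSrc leftTgt (.left i) (.white (leftTgt i)) (w (Sum.inr i))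

/-- A marking of `D`: the right and left ends of the prescribed weights are attached to white
vertices, such that every white vertex has divergence `k`, and the order of the white vertices is
extended to a total order on all vertices, compatible with the orientation of all edges. -/
structure Marking (k : ℕ) (w : EndWeights lr ll) where
  rightSrc : Fin lr → Fin a
  leftTgt : Fin ll → Fin a
  div_eq : ∀ v, D.div v + ∑ i with leftTgt i = v, ((w (Sum.inr i) : ℕ) : ℤ) -
    ∑ j with rightSrc j = v, ((w (Sum.inl j) : ℕ) : ℤ) = k
  lt : D.MarkedVertex lr ll → D.MarkedVertex lr ll → Prop
  isStrictTotalOrder : IsStrictTotalOrder _ lt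
  white_lt_white : ∀ u v, lt (.white u) (.white v) ↔ u < v
  lt_of_arc : ∀ x y n, D.MarkedArc w rightSrc leftTgt x y n → lt x y

/-- Two markings of `D` are equivalent if there is an isomorphism of weighted graphs between them
which fixes the white vertices and preserves the total orders. -/
def Marking.Equivalent {D : FloorDiagram a} {k : ℕ} {w : EndWeights lr ll} (m m' : D.Marking k w) :
    Prop :=
  ∃ σ : D.MarkedVertex lr ll ≃ D.MarkedVertex lr ll,
    (∀ v, σ (.white v) = .white v) ∧
    (∀ x y n, D.MarkedArc w m.rightSrc m.leftTgt x y n ↔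
      D.MarkedArc w m'.rightSrc m'.leftTgt (σ x) (σ y) n) ∧
    ∀ x y, m.lt x y ↔ m'.lt (σ x) (σ y)

instance Marking.setoid {D : FloorDiagram a} (k : ℕ) (w : EndWeights lr ll) :
    Setoid (D.Marking k w) where
  r := Marking.Equivalent
  iseqv :=
    { refl := fun _ => ⟨Equiv.refl _, fun _ => rfl, fun _ _ _ => Iff.rfl, fun _ _ => Iff.rfl⟩
      symm := fun ⟨σ, h₁, h₂, h₃⟩ => ⟨σ.symm, fun v => by rw [Equiv.symm_apply_eq, h₁],
        fun x y n => by simp [h₂], fun x y => by simp [h₃]⟩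
      trans := fun ⟨σ, h₁, h₂, h₃⟩ ⟨τ, k₁, k₂, k₃⟩ => ⟨σ.trans τ, fun v => by simp [h₁, k₁],
        fun x y n => by simp [h₂, k₂], fun x y => by simp [h₃, k₃]⟩ }

/-- The number of markings of `D` up to equivalence. -/
noncomputable def numMarkings (k : ℕ) (w : EndWeights lr ll) : ℕ :=
  Nat.card (Quotient (Marking.setoid (D := D) k w))

/-- The weights of all edges of a marked floor diagram arising from `D`; each edge of `D`
contributes the weights of its two halves. -/
def markedWeights (w : EndWeights lr ll) : Multiset ℕ+ :=
  (D.edges.map fun e => e.weight) + (D.edges.map fun e => e.weight) + Finset.univ.val.map w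

end FloorDiagram

section Arithmetic

variable (K : Type u) [Field K] [CharZero K]

/-- A positive integer as a unit of a field of characteristic zero. -/
def natUnit (n : ℕ+) : Kˣ := Units.mk0 ((n : ℕ) : K) (Nat.cast_ne_zero.2 n.ne_zero)

/-- The arithmetic multiplicity of an edge of weight `n`. -/
noncomputable def edgeMult (n : ℕ+) : GW K :=
  if Odd (n : ℕ) then (((n : ℕ) - 1) / 2) • GW.hyperbolic K + GW.unitForm (natUnit K n)
  else ((n : ℕ) / 2) • GW.hyperbolic K

/-- The arithmetic multiplicity of a floor diagram with ends of weights `w`: the product of the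
arithmetic multiplicities of all edges of the associated marked floor diagrams. -/
noncomputable def FloorDiagram.mult {a lr ll : ℕ} (D : FloorDiagram a) (w : EndWeights lr ll) :
    GW K :=
  ((D.markedWeights w).map (edgeMult K)).prod

/-- The arithmetic count of the connected floor diagrams of genus `g` on `a` vertices with
divergences at most `c`, each one weighted by its multiplicity and by its number of markings.
Only finitely many of them have a marking, so that the sum is a finite one. -/
noncomputable def floorCount (k a g : ℕ) (c : WithTop ℤ) {lr ll : ℕ} (w : EndWeights lr ll) :
    GW K :=
  ∑ᶠ (D : FloorDiagram a) (_ : D.IsAdmissible g c), D.numMarkings k w • D.mult K w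

end Arithmetic

/-- `f` is piecewise polynomial on `S`: there are finitely many affine-linear forms with rational
coefficients such that on the set of all points of `S` at which they have any prescribed signs
(negative, zero or positive), `f` is given by a polynomial with rational coefficients. -/
def IsPiecewisePolynomialOn {ι : Type*} [Fintype ι] (S : Set (ι → ℕ+)) (f : (ι → ℕ+) → ℤ) : Prop :=
  ∃ (m : ℕ) (A : Fin m → ι → ℚ) (B : Fin m → ℚ), ∀ s : Fin m → SignType,
    ∃ p : MvPolynomial ι ℚ, ∀ x ∈ S,
      (∀ t, SignType.sign (∑ i, A t i * ((x i : ℕ) : ℚ) + B t) = s t) →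
        (f x : ℚ) = MvPolynomial.eval (fun i => ((x i : ℕ) : ℚ)) p

/-! In $\mathrm{GW}(K)$ one has $\mathbb H\langle u\rangle=\mathbb H$ and $\mathbb H^2=2\mathbb H$,
so a product of edge multiplicities is a multiple of $\mathbb H$ plus at most one rank-one form, and
the multiple can be read off from the rank. If some weight is even, no rank-one form survives. If
all are odd, it is the class of the product of all weights. There every edge of $\mathcal D$ occurs
twice, so up to squares only the ends remain, and $i_{\mathcal D}=0$ works (`mult_eq`). Hence $2M$
is the sum of $\nu(\mathcal D)$ times the product of all weights, minus the sum of $\nu(\mathcal D)$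
over the odd diagrams.

For piecewise polynomiality, label the $m=g+a-1$ edges. Permutations of edges and ends act freely on
markings, so passing to labelled objects multiplies $\nu(\mathcal D)$ by $m!$, up to the symmetries
of $\mathcal D$, and by the number of weight-preserving permutations of the ends, which depends only
on the coincidences among end weights (`card_labelled_markings`). Labelled marked diagrams fall into
finitely many combinatorial types. For each type the number of total orders is constant, and the
edge weights are the positive integral flows on a fixed acyclic graph whose net inflow is
affine-linear in the end weights. The first sum thus becomes a sum of $\prod_e y_e^2$ over lattice
points. The second counts odd flows, which the substitution $y=2x+1$ turns into ordinary lattice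
points.

The analytic core is `isPiecewisePoly_sum_flowFiber`: sums of a polynomial over such flows are
piecewise polynomial in the inflow. If the free edges contain a cycle, the summand is a difference
along the corresponding circulation, whose values are $0,\pm1$, and the sum telescopes to faces on
which one more edge is fixed. If they form a forest, there is at most one flow, and it is an affine
function of the inflow. Unimodularity of the graph is what excludes quasi-polynomials. -/

namespace GW

/-! ### Relations in the Grothendieck–Witt ring -/

variable {K : Type u} [Field K]

theorem ofClass_mk_eq {X Y : QuadSpace K} (h : QuadSpace.Isometric X Y) :
    ofClass (QuadClass.mk X) = ofClass (QuadClass.mk Y) :=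
  congrArg ofClass (Quotient.sound h)

theorem one_eq_unitForm : (1 : GW K) = unitForm 1 := rfl

theorem unitForm_mul_unitForm (a b : Kˣ) : unitForm a * unitForm b = unitForm (a * b) := by
  rw [unitForm, unitForm, ← ofClass_mul]
  refine ofClass_mk_eq (X := (QuadSpace.line a).tensor (QuadSpace.line b))
    ⟨TensorProduct.lid K K, QuadSpace.tmul_isometry (QuadSpace.line a).form
      (QuadSpace.line b).form (QuadSpace.line (a * b)).form
      (TensorProduct.lid K K).toLinearMap fun (x x' : K) (y y' : K) => ?_⟩
  change ((a * b : Kˣ) : K) * ((x * y) * (x' * y')) = (a * (x * x')) * (b * (y * y'))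
  push_cast
  ring

theorem unitForm_sq_mul (a b : Kˣ) : unitForm (b ^ 2 * a) = unitForm a := by
  refine ofClass_mk_eq ⟨LinearEquiv.smulOfUnit b, fun (x y : K) => ?_⟩
  change (a : K) * (((b : K) * x) * ((b : K) * y)) = ((b ^ 2 * a : Kˣ) : K) * (x * y)
  push_cast
  ring

/-- In the isotropic coordinates $s=x+y$, $t=x-y$ the form $u(x^2-y^2)$ is $u\,st$. Scaling $s$ by
$u$ and keeping $t$ turns it into $x^2-y^2$; this is the map `e`. -/
theorem unitForm_add_unitForm_neg [CharZero K] (u : Kˣ) :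
    unitForm u + unitForm (-u) = hyperbolic K := by
  rw [hyperbolic, unitForm, unitForm, unitForm, unitForm, ← map_add, ← map_add]
  have hu : (u : K) ≠ 0 := u.ne_zero
  let e : (K × K) ≃ₗ[K] (K × K) :=
    { toFun := fun p => (((u : K) + 1) / 2 * p.1 + ((u : K) - 1) / 2 * p.2,
        ((u : K) - 1) / 2 * p.1 + ((u : K) + 1) / 2 * p.2)
      invFun := fun p => (((u : K)⁻¹ + 1) / 2 * p.1 + ((u : K)⁻¹ - 1) / 2 * p.2,
        ((u : K)⁻¹ - 1) / 2 * p.1 + ((u : K)⁻¹ + 1) / 2 * p.2)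
      map_add' := fun p q => by ext <;> simp <;> ring
      map_smul' := fun c p => by ext <;> simp <;> ring
      left_inv := fun p => by ext <;> simp <;> field_simp <;> ring
      right_inv := fun p => by ext <;> simp <;> field_simp <;> ring }
  refine ofClass_mk_eq (X := (QuadSpace.line u).directSum (QuadSpace.line (-u)))
    (Y := (QuadSpace.line 1).directSum (QuadSpace.line (-1))) ⟨e, fun (x y : K × K) => ?_⟩
  change ((1 : Kˣ) : K) * ((e x).1 * (e y).1) + ((-1 : Kˣ) : K) * ((e x).2 * (e y).2) =
    (u : K) * (x.1 * y.1) + ((-u : Kˣ) : K) * (x.2 * y.2)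
  simp only [e, LinearEquiv.coe_mk, LinearMap.coe_mk, AddHom.coe_mk, Units.val_one, Units.val_neg]
  field_simp
  ring

theorem hyperbolic_mul_unitForm [CharZero K] (u : Kˣ) :
    hyperbolic K * unitForm u = hyperbolic K := by
  rw [hyperbolic, add_mul, unitForm_mul_unitForm, unitForm_mul_unitForm, one_mul, neg_one_mul,
    unitForm_add_unitForm_neg, hyperbolic]

theorem hyperbolic_mul_hyperbolic [CharZero K] :
    hyperbolic K * hyperbolic K = 2 • hyperbolic K := by
  nth_rewrite 2 [hyperbolic]
  rw [mul_add, hyperbolic_mul_unitForm, hyperbolic_mul_unitForm, two_nsmul]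

end GW

/-! ### Arithmetic multiplicities of floor diagrams -/

section Arithmetic

variable (K : Type u) [Field K] [CharZero K]

theorem natUnit_one : natUnit K 1 = 1 := by
  ext; simp [natUnit]

theorem natUnit_mul (m n : ℕ+) : natUnit K (m * n) = natUnit K m * natUnit K n := by
  ext; simp [natUnit]

theorem natUnit_prod {ι : Type*} (s : Finset ι) (f : ι → ℕ+) :
    natUnit K (∏ i ∈ s, f i) = ∏ i ∈ s, natUnit K (f i) :=
  map_prod (⟨⟨natUnit K, natUnit_one K⟩, natUnit_mul K⟩ : ℕ+ →* Kˣ) f s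

/-- Multiplication by $\mathbb H$ sees only the rank, and the multiplicity of an edge of weight $n$
has rank $n$. -/
theorem hyperbolic_mul_edgeMult (n : ℕ+) :
    GW.hyperbolic K * edgeMult K n = (n : ℕ) • GW.hyperbolic K := by
  rw [edgeMult]
  split_ifs with h
  · obtain ⟨t, ht⟩ := h
    have e : ((n : ℕ) - 1) / 2 = t := by omega
    rw [e, mul_add, mul_smul_comm, GW.hyperbolic_mul_hyperbolic, GW.hyperbolic_mul_unitForm, ht,
      smul_smul, add_smul, one_smul, mul_comm]
  · obtain ⟨t, ht⟩ := Nat.not_odd_iff_even.1 h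
    have e : (n : ℕ) / 2 = t := by omega
    rw [e, mul_smul_comm, GW.hyperbolic_mul_hyperbolic, ht, smul_smul, mul_two]

theorem hyperbolic_mul_prod_edgeMult (s : Multiset ℕ+) :
    GW.hyperbolic K * (s.map (edgeMult K)).prod = (s.prod : ℕ) • GW.hyperbolic K := by
  induction s using Multiset.induction with
  | empty => simp
  | cons n s ih =>
    rw [Multiset.map_cons, Multiset.prod_cons, ← mul_assoc, hyperbolic_mul_edgeMult,
      smul_mul_assoc, ih, smul_smul, Multiset.prod_cons, PNat.mul_coe]

/-- When the product is expanded, every term except the product of the rank-one forms contains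
$\mathbb H$ and is therefore an integral multiple of it. Comparing ranks gives the coefficient `t`.
-/
theorem prod_edgeMult_of_odd (s : Multiset ℕ+) (hs : ∀ n ∈ s, Odd (n : ℕ)) :
    ∀ t : ℕ, ((s.prod : ℕ+) : ℕ) = 2 * t + 1 →
      (s.map (edgeMult K)).prod = t • GW.hyperbolic K + GW.unitForm (natUnit K s.prod) := by
  induction s using Multiset.induction with
  | empty =>
    intro t ht
    have : t = 0 := by simpa using ht
    simp [this, natUnit_one, GW.one_eq_unitForm]
  | cons n s ih =>
    intro t ht
    have hn : Odd (n : ℕ) := hs n (Multiset.mem_cons_self n s)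
    have hodd : Odd ((s.prod : ℕ+) : ℕ) := by
      rw [Multiset.prod_cons, PNat.mul_coe] at ht
      exact (Nat.odd_mul.1 ⟨t, ht⟩).2
    obtain ⟨r, hr⟩ := hodd
    have hP := ih (fun x hx => hs x (Multiset.mem_cons_of_mem hx)) r hr
    have hH := hyperbolic_mul_prod_edgeMult K s
    rw [Multiset.map_cons, Multiset.prod_cons]
    obtain ⟨q, hq⟩ := hn
    have e : ((n : ℕ) - 1) / 2 = q := by omega
    have h1 : edgeMult K n = q • GW.hyperbolic K + GW.unitForm (natUnit K n) := by
      rw [edgeMult, if_pos ⟨q, hq⟩, e]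
    rw [h1, add_mul, smul_mul_assoc, hH, hP, mul_add, mul_smul_comm, GW.unitForm_mul_unitForm,
      mul_comm (GW.unitForm _) (GW.hyperbolic K), GW.hyperbolic_mul_unitForm, Multiset.prod_cons,
      natUnit_mul, ← add_assoc, smul_smul, ← add_smul]
    congr 2
    rw [Multiset.prod_cons, PNat.mul_coe, hq, hr] at ht
    rw [hr]
    nlinarith

/-- One even weight contributes a pure multiple of $\mathbb H$, which absorbs all other factors
through their ranks. -/
theorem prod_edgeMult_of_even (s : Multiset ℕ+) {n : ℕ+} (hn : n ∈ s) (he : Even (n : ℕ)) :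
    (s.map (edgeMult K)).prod = (((s.prod : ℕ+) : ℕ) / 2) • GW.hyperbolic K := by
  obtain ⟨t, rfl⟩ := Multiset.exists_cons_of_mem hn
  obtain ⟨q, hq⟩ := he
  have e : (n : ℕ) / 2 = q := by omega
  rw [Multiset.map_cons, Multiset.prod_cons, Multiset.prod_cons, edgeMult,
    if_neg (Nat.not_odd_iff_even.2 ⟨q, hq⟩), smul_mul_assoc, hyperbolic_mul_prod_edgeMult,
    smul_smul, PNat.mul_coe, e, hq]
  congr 1
  rw [← two_mul, mul_assoc, Nat.mul_div_cancel_left _ two_pos]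

namespace FloorDiagram

variable {a lr ll : ℕ} (D : FloorDiagram a) (w : EndWeights lr ll)

theorem prod_markedWeights :
    (D.markedWeights w).prod = (D.edges.map fun e => e.weight).prod ^ 2 * ∏ x, w x := by
  rw [markedWeights, Multiset.prod_add, Multiset.prod_add, sq]
  rfl

theorem forall_odd_markedWeights (hw : ∀ x, Odd (w x : ℕ)) :
    (∀ n ∈ D.markedWeights w, Odd (n : ℕ)) ↔ D.IsOdd := by
  simp only [markedWeights, Multiset.mem_add, Multiset.mem_map, IsOdd]
  constructor
  · intro h e he
    exact h _ (Or.inl (Or.inl ⟨e, he, rfl⟩))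
  · rintro h n ((⟨e, he, rfl⟩ | ⟨e, he, rfl⟩) | ⟨x, -, rfl⟩)
    · exact h e he
    · exact h e he
    · exact hw x

open Classical in
/-- The coefficient of the hyperbolic plane in the multiplicity of a floor diagram. -/
noncomputable def hyperbolicCoeff : ℤ :=
  ((((D.markedWeights w).prod : ℕ+) : ℤ) - if D.IsOdd then 1 else 0) / 2

-- The integer division in `hyperbolicCoeff` is exact, because the product of all weights is odd
-- precisely when every edge weight of `D` is odd.
open Classical in
theorem two_mul_hyperbolicCoeff (hw : ∀ x, Odd (w x : ℕ)) :
    2 * D.hyperbolicCoeff w =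
      (((D.markedWeights w).prod : ℕ+) : ℤ) - if D.IsOdd then 1 else 0 := by
  refine Int.mul_ediv_cancel' ?_
  have key : ∀ s : Multiset ℕ+, Odd ((s.prod : ℕ+) : ℕ) ↔ ∀ n ∈ s, Odd (n : ℕ) := by
    intro s
    induction s using Multiset.induction with
    | empty => simp
    | cons n s ih => simp [Nat.odd_mul, ih]
  have := key (D.markedWeights w)
  rw [D.forall_odd_markedWeights w hw] at this
  split_ifs with h
  · obtain ⟨t, ht⟩ := this.2 h
    exact ⟨t, by push_cast [ht]; ring⟩
  · obtain ⟨t, ht⟩ := Nat.not_odd_iff_even.1 (fun h' => h (this.1 h'))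
    exact ⟨t, by push_cast [ht]; ring⟩

open Classical in
theorem mult_eq (hw : ∀ x, Odd (w x : ℕ)) :
    D.mult K w = D.hyperbolicCoeff w • GW.hyperbolic K +
      if D.IsOdd then GW.unitForm ((∏ j, natUnit K (w (Sum.inl j))) *
              (∏ j, natUnit K (w (Sum.inr j)))) else 0 := by
  have h2 := D.two_mul_hyperbolicCoeff w hw
  have hall := D.forall_odd_markedWeights w hw
  rw [mult]
  split_ifs with h
  · rw [if_pos h] at h2
    have hpos : 0 ≤ D.hyperbolicCoeff w := by
      have := (D.markedWeights w).prod.pos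
      omega
    obtain ⟨t, ht⟩ := Int.eq_ofNat_of_zero_le hpos
    -- The two halves of each edge contribute a square, which does not change the class of the
    -- rank-one form; only the end weights remain.
    rw [prod_edgeMult_of_odd K _ (hall.2 h) t (by omega), ht, natCast_zsmul, prod_markedWeights,
      natUnit_mul, sq, natUnit_mul, ← sq, GW.unitForm_sq_mul, natUnit_prod,
      Fintype.prod_sum_type]
  · have hex : ∃ n ∈ D.markedWeights w, Even (n : ℕ) := by
      by_contra! hne
      exact h (hall.1 fun n hn => Nat.not_even_iff_odd.1 (hne n hn))
    obtain ⟨n, hn, he⟩ := hex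
    rw [prod_edgeMult_of_even K _ hn he, add_zero, ← natCast_zsmul]
    congr 1
    rw [hyperbolicCoeff, if_neg h, sub_zero]
    simp

end FloorDiagram

end Arithmetic

/-! ### Closure properties of piecewise polynomial functions -/

section PiecewisePolynomial

variable {ι : Type*} [Fintype ι]

/-- `f` agrees on `S` with an affine-linear form with rational coefficients. -/
def IsAffineOn (S : Set (ι → ℕ+)) (f : (ι → ℕ+) → ℚ) : Prop :=
  ∃ (A : ι → ℚ) (B : ℚ), ∀ x ∈ S, f x = ∑ i, A i * ((x i : ℕ) : ℚ) + B

namespace IsAffineOn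

variable {S : Set (ι → ℕ+)} {f g : (ι → ℕ+) → ℚ}

theorem const (c : ℚ) : IsAffineOn S fun _ => c := ⟨0, c, by simp⟩

theorem coord (i : ι) : IsAffineOn S fun x => ((x i : ℕ) : ℚ) := by
  classical
  exact ⟨Pi.single i 1, 0, by simp [Pi.single_apply]⟩

theorem add (hf : IsAffineOn S f) (hg : IsAffineOn S g) : IsAffineOn S fun x => f x + g x := by
  obtain ⟨A, B, h⟩ := hf
  obtain ⟨A', B', h'⟩ := hg
  refine ⟨A + A', B + B', fun x hx => ?_⟩
  beta_reduce
  rw [h x hx, h' x hx]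
  simp only [Pi.add_apply, add_mul, Finset.sum_add_distrib]
  ring

theorem const_mul (c : ℚ) (hf : IsAffineOn S f) : IsAffineOn S fun x => c * f x := by
  obtain ⟨A, B, h⟩ := hf
  refine ⟨c • A, c * B, fun x hx => ?_⟩
  beta_reduce
  rw [h x hx, mul_add, Finset.mul_sum]
  simp only [Pi.smul_apply, smul_eq_mul, mul_assoc]

theorem sub (hf : IsAffineOn S f) (hg : IsAffineOn S g) : IsAffineOn S fun x => f x - g x := by
  simpa [sub_eq_add_neg] using hf.add (hg.const_mul (-1))

theorem sum {κ : Type*} (s : Finset κ) {F : κ → (ι → ℕ+) → ℚ}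
    (h : ∀ j ∈ s, IsAffineOn S (F j)) : IsAffineOn S fun x => ∑ j ∈ s, F j x := by
  classical
  induction s using Finset.induction_on with
  | empty => simpa using const 0
  | insert j s hj ih =>
    simp only [Finset.sum_insert hj]
    exact (h j (Finset.mem_insert_self j s)).add
      (ih fun i hi => h i (Finset.mem_insert_of_mem hi))

theorem congr (hf : IsAffineOn S f) (h : ∀ x ∈ S, g x = f x) : IsAffineOn S g := by
  obtain ⟨A, B, hAB⟩ := hf
  exact ⟨A, B, fun x hx => (h x hx).trans (hAB x hx)⟩

end IsAffineOn

/-- Piecewise polynomiality of a rational-valued function on `S`, with any finite type of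
affine-linear forms. -/
def IsPiecewisePoly (S : Set (ι → ℕ+)) (f : (ι → ℕ+) → ℚ) : Prop :=
  ∃ (τ : Type) (_ : Fintype τ) (A : τ → ι → ℚ) (B : τ → ℚ), ∀ s : τ → SignType,
    ∃ p : MvPolynomial ι ℚ, ∀ x ∈ S,
      (∀ t, SignType.sign (∑ i, A t i * ((x i : ℕ) : ℚ) + B t) = s t) →
        f x = MvPolynomial.eval (fun i => ((x i : ℕ) : ℚ)) p

namespace IsPiecewisePoly

variable {S : Set (ι → ℕ+)} {f g : (ι → ℕ+) → ℚ}

theorem isPiecewisePolynomialOn {f : (ι → ℕ+) → ℤ} (hf : IsPiecewisePoly S fun x => (f x : ℚ)) :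
    IsPiecewisePolynomialOn S f := by
  obtain ⟨τ, _, A, B, h⟩ := hf
  let e := Fintype.equivFin τ
  refine ⟨Fintype.card τ, fun t => A (e.symm t), fun t => B (e.symm t), fun s => ?_⟩
  obtain ⟨p, hp⟩ := h (s ∘ e)
  refine ⟨p, fun x hx hs => hp x hx fun t => ?_⟩
  simpa using hs (e t)

theorem congr (hf : IsPiecewisePoly S f) (h : ∀ x ∈ S, g x = f x) : IsPiecewisePoly S g := by
  obtain ⟨τ, i, A, B, hAB⟩ := hf
  refine ⟨τ, i, A, B, fun s => ?_⟩
  obtain ⟨p, hp⟩ := hAB s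
  exact ⟨p, fun x hx hs => (h x hx).trans (hp x hx hs)⟩

theorem const (c : ℚ) : IsPiecewisePoly S fun _ => c :=
  ⟨Empty, inferInstance, fun t => t.elim, fun t => t.elim, fun _ => ⟨MvPolynomial.C c, by simp⟩⟩

theorem of_isAffineOn (hf : IsAffineOn S f) : IsPiecewisePoly S f := by
  obtain ⟨A, B, h⟩ := hf
  refine ⟨Empty, inferInstance, fun t => t.elim, fun t => t.elim, fun _ =>
    ⟨∑ i, MvPolynomial.C (A i) * MvPolynomial.X i + MvPolynomial.C B, fun x hx _ => ?_⟩⟩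
  simp [h x hx]

/-- The two systems of affine forms taken together cut out a common refinement of both subdivisions.
-/
theorem map₂ (op : ℚ → ℚ → ℚ) (P : MvPolynomial ι ℚ → MvPolynomial ι ℚ → MvPolynomial ι ℚ)
    (hP : ∀ v p q, MvPolynomial.eval v (P p q) = op (MvPolynomial.eval v p) (MvPolynomial.eval v q))
    (hf : IsPiecewisePoly S f) (hg : IsPiecewisePoly S g) :
    IsPiecewisePoly S fun x => op (f x) (g x) := by
  obtain ⟨τ, _, A, B, h⟩ := hf
  obtain ⟨τ', _, A', B', h'⟩ := hg
  refine ⟨τ ⊕ τ', inferInstance, Sum.elim A A', Sum.elim B B', fun s => ?_⟩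
  obtain ⟨p, hp⟩ := h (s ∘ Sum.inl)
  obtain ⟨q, hq⟩ := h' (s ∘ Sum.inr)
  refine ⟨P p q, fun x hx hs => ?_⟩
  beta_reduce
  rw [hP, hp x hx fun t => hs (Sum.inl t), hq x hx fun t => hs (Sum.inr t)]

theorem add (hf : IsPiecewisePoly S f) (hg : IsPiecewisePoly S g) :
    IsPiecewisePoly S fun x => f x + g x :=
  map₂ (· + ·) (· + ·) (by simp) hf hg

theorem mul (hf : IsPiecewisePoly S f) (hg : IsPiecewisePoly S g) :
    IsPiecewisePoly S fun x => f x * g x :=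
  map₂ (· * ·) (· * ·) (by simp) hf hg

theorem sub (hf : IsPiecewisePoly S f) (hg : IsPiecewisePoly S g) :
    IsPiecewisePoly S fun x => f x - g x :=
  map₂ (· - ·) (· - ·) (by simp) hf hg

theorem sum {κ : Type*} (s : Finset κ) {F : κ → (ι → ℕ+) → ℚ}
    (h : ∀ j ∈ s, IsPiecewisePoly S (F j)) : IsPiecewisePoly S fun x => ∑ j ∈ s, F j x := by
  classical
  induction s using Finset.induction_on with
  | empty => simpa using const 0
  | insert j s hj ih =>
    simp only [Finset.sum_insert hj]
    exact (h j (Finset.mem_insert_self j s)).add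
      (ih fun i hi => h i (Finset.mem_insert_of_mem hi))

theorem prod {κ : Type*} (s : Finset κ) {F : κ → (ι → ℕ+) → ℚ}
    (h : ∀ j ∈ s, IsPiecewisePoly S (F j)) : IsPiecewisePoly S fun x => ∏ j ∈ s, F j x := by
  classical
  induction s using Finset.induction_on with
  | empty => simpa using const 1
  | insert j s hj ih =>
    simp only [Finset.prod_insert hj]
    exact (h j (Finset.mem_insert_self j s)).mul
      (ih fun i hi => h i (Finset.mem_insert_of_mem hi))

theorem eval {κ : Type*} (q : MvPolynomial κ ℚ) {F : κ → (ι → ℕ+) → ℚ}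
    (h : ∀ j, IsPiecewisePoly S (F j)) :
    IsPiecewisePoly S fun x => MvPolynomial.eval (fun j => F j x) q := by
  induction q using MvPolynomial.induction_on with
  | C c => simpa using const c
  | add p q hp hq => simpa using hp.add hq
  | mul_X p j hp => simpa using hp.mul (h j)

theorem indicator_sign (hf : IsAffineOn S f) (P : SignType → Prop)
    [DecidablePred fun x => P (SignType.sign (f x))] :
    IsPiecewisePoly S fun x => if P (SignType.sign (f x)) then 1 else 0 := by
  classical
  obtain ⟨A, B, h⟩ := hf
  refine ⟨Unit, inferInstance, fun _ => A, fun _ => B, fun s =>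
    ⟨if P (s ()) then 1 else 0, fun x hx hs => ?_⟩⟩
  have hs' : SignType.sign (f x) = s () := by
    rw [h x hx]
    exact hs ()
  by_cases hP : P (s ()) <;> simp [hs', hP]

theorem indicator_nonneg (hf : IsAffineOn S f) [DecidablePred fun x => 0 ≤ f x] :
    IsPiecewisePoly S fun x => if 0 ≤ f x then 1 else 0 := by
  classical
  refine (indicator_sign hf fun s => 0 ≤ s).congr fun x _ => ?_
  simp only [sign_nonneg_iff]

theorem indicator_eq_zero (hf : IsAffineOn S f) [DecidablePred fun x => f x = 0] :
    IsPiecewisePoly S fun x => if f x = 0 then 1 else 0 := by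
  classical
  refine (indicator_sign hf fun s => s = 0).congr fun x _ => ?_
  simp only [sign_eq_zero_iff]

theorem indicator_and {P Q : (ι → ℕ+) → Prop} [DecidablePred P] [DecidablePred Q]
    [DecidablePred fun x => P x ∧ Q x]
    (hP : IsPiecewisePoly S fun x => if P x then 1 else 0)
    (hQ : IsPiecewisePoly S fun x => if Q x then 1 else 0) :
    IsPiecewisePoly S fun x => if P x ∧ Q x then 1 else 0 := by
  refine (hP.mul hQ).congr fun x _ => ?_
  by_cases h : P x <;> by_cases h' : Q x <;> simp [h, h']

theorem indicator_forall {κ : Type*} (s : Finset κ) {P : κ → (ι → ℕ+) → Prop}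
    [∀ j, DecidablePred (P j)] [DecidablePred fun x => ∀ j ∈ s, P j x]
    (h : ∀ j ∈ s, IsPiecewisePoly S fun x => if P j x then 1 else 0) :
    IsPiecewisePoly S fun x => if ∀ j ∈ s, P j x then 1 else 0 := by
  refine (prod s h).congr fun x _ => ?_
  rw [Finset.prod_ite_zero]
  simp

/-- A function which depends only on the coincidences between the coordinates. -/
theorem of_coincidences (h : (ι → ι → Prop) → ℚ) :
    IsPiecewisePoly S fun x => h fun i j => x i = x j := by
  classical
  let n := Fintype.card ι
  let e : ι ≃ Fin n := Fintype.equivFin ι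
  -- The forms are all differences of two coordinates; vanishing of their signs records the
  -- coincidences, so `h` is constant on each piece.
  refine ⟨Fin n × Fin n, inferInstance,
    fun t => Pi.single (e.symm t.1) 1 - Pi.single (e.symm t.2) 1, fun _ => 0,
    fun s => ⟨MvPolynomial.C (h fun i j => s (e i, e j) = 0), fun x hx hs => ?_⟩⟩
  rw [MvPolynomial.eval_C]
  beta_reduce
  congr 1
  ext i j
  rw [← hs (e i, e j)]
  simp [sub_mul, Finset.sum_sub_distrib, Pi.single_apply, sub_eq_zero]

end IsPiecewisePoly

end PiecewisePolynomial

/-! ### Polynomial antidifferences along a vector -/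

section Antidifference

variable {κ : Type*} (δ : κ → ℚ)

/-- Polynomials that are invariant under the translation by `δ`. -/
def IsShiftInvariant (r : MvPolynomial κ ℚ) : Prop :=
  ∀ x : κ → ℚ, MvPolynomial.eval (x - δ) r = MvPolynomial.eval x r

/-- The invariant factor `r` behaves like a constant, so this is the one-variable problem in `t`,
solved by $B_{n+1}(t+1)-B_{n+1}(t)=(n+1)t^n$ for the Bernoulli polynomials. -/
theorem exists_antidifference_mul_pow {r t : MvPolynomial κ ℚ} (hr : IsShiftInvariant δ r)
    (ht : ∀ x : κ → ℚ, MvPolynomial.eval (x - δ) t = MvPolynomial.eval x t - 1) (n : ℕ) :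
    ∃ Q : MvPolynomial κ ℚ, ∀ x : κ → ℚ, MvPolynomial.eval x Q - MvPolynomial.eval (x - δ) Q =
      MvPolynomial.eval x (r * t ^ n) := by
  refine ⟨MvPolynomial.C ((n + 1 : ℚ)⁻¹) *
    (r * Polynomial.aeval (1 + t) (Polynomial.bernoulli (n + 1))), fun x => ?_⟩
  have key : ∀ y : κ → ℚ, MvPolynomial.eval y
      (Polynomial.aeval (1 + t) (Polynomial.bernoulli (n + 1))) =
      Polynomial.eval (1 + MvPolynomial.eval y t) (Polynomial.bernoulli (n + 1)) := by
    intro y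
    rw [← MvPolynomial.coe_aeval_eq_eval, RingHom.coe_coe, ← Polynomial.aeval_algHom_apply]
    simp [Polynomial.aeval_def, Polynomial.eval₂_eq_eval_map]
  have hB := Polynomial.bernoulli_eval_one_add (n + 1) (MvPolynomial.eval x t)
  have hn : (n + 1 : ℚ) ≠ 0 := by positivity
  simp only [map_mul, MvPolynomial.eval_C, key, hr x, ht, map_pow, add_sub_cancel]
  rw [hB]
  push_cast
  field_simp
  ring

/-- Change coordinates to $t=X_e/\delta_e$, which drops by one under the translation, and to the
invariant $y_f=X_f-\delta_f t$. Since $X_f=y_f+\delta_f t$, every polynomial is a combination of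
products $r\,t^n$ with $r$ invariant. -/
theorem exists_antidifference {e : κ} (he : δ e ≠ 0) (q : MvPolynomial κ ℚ) :
    ∃ Q : MvPolynomial κ ℚ, ∀ x : κ → ℚ,
      MvPolynomial.eval x Q - MvPolynomial.eval (x - δ) Q = MvPolynomial.eval x q := by
  let t : MvPolynomial κ ℚ := MvPolynomial.C (δ e)⁻¹ * MvPolynomial.X e
  have ht : ∀ x : κ → ℚ, MvPolynomial.eval (x - δ) t = MvPolynomial.eval x t - 1 := by
    intro x
    simp only [t, map_mul, MvPolynomial.eval_C, MvPolynomial.eval_X, Pi.sub_apply]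
    field_simp
  let y : κ → MvPolynomial κ ℚ := fun f => MvPolynomial.X f - MvPolynomial.C (δ f) * t
  have hy : ∀ f, IsShiftInvariant δ (y f) := by
    intro f x
    simp only [y, map_sub, map_mul, MvPolynomial.eval_C, MvPolynomial.eval_X, ht, Pi.sub_apply]
    ring
  let N : Submodule ℚ (MvPolynomial κ ℚ) :=
    Submodule.span ℚ {p | ∃ r n, IsShiftInvariant δ r ∧ p = r * t ^ n}
  have hX : ∀ p ∈ N, ∀ f, p * MvPolynomial.X f ∈ N := by
    intro p hp f
    induction hp using Submodule.span_induction with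
    | mem p hp =>
      obtain ⟨r, n, hr, rfl⟩ := hp
      have : r * t ^ n * MvPolynomial.X f = (r * y f) * t ^ n + δ f • (r * t ^ (n + 1)) := by
        simp only [y, MvPolynomial.smul_eq_C_mul]
        ring
      rw [this]
      refine N.add_mem (Submodule.subset_span ⟨_, n, fun x => ?_, rfl⟩)
        (N.smul_mem _ (Submodule.subset_span ⟨_, _, hr, rfl⟩))
      rw [map_mul, map_mul, hr x, hy f x]
    | zero => simp
    | add p p' _ _ h h' => rw [add_mul]; exact N.add_mem h h'
    | smul c p _ h => rw [smul_mul_assoc]; exact N.smul_mem c h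
  have hN : ∀ p, p ∈ N := by
    intro p
    induction p using MvPolynomial.induction_on with
    | C c => exact Submodule.subset_span ⟨MvPolynomial.C c, 0, fun x => by simp, by simp⟩
    | add p p' h h' => exact N.add_mem h h'
    | mul_X p f h => exact hX p h f
  have hq := hN q
  induction hq using Submodule.span_induction with
  | mem p hp =>
    obtain ⟨r, n, hr, rfl⟩ := hp
    exact exists_antidifference_mul_pow δ hr ht n
  | zero => exact ⟨0, by simp⟩
  | add p p' _ _ h h' =>
    obtain ⟨Q, hQ⟩ := h
    obtain ⟨Q', hQ'⟩ := h'
    refine ⟨Q + Q', fun x => ?_⟩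
    rw [map_add, map_add, map_add, ← hQ, ← hQ']
    ring
  | smul c p _ h =>
    obtain ⟨Q, hQ⟩ := h
    refine ⟨c • Q, fun x => ?_⟩
    rw [MvPolynomial.smul_eval, MvPolynomial.smul_eval, MvPolynomial.smul_eval, ← hQ]
    ring

end Antidifference

/-! ### Sums of polynomials over integral flows on a graph -/

section Flow

variable {a m : ℕ} (src tgt : Fin m → Fin a)

/-- The net inflow at the vertices of the graph with edges `src e → tgt e` carrying the flow
`x e`. -/
def netFlow : (Fin m → ℤ) →+ (Fin a → ℤ) where
  toFun x v := ∑ e, x e * ((if tgt e = v then 1 else 0) - if src e = v then 1 else 0)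
  map_zero' := by ext v; simp
  map_add' x y := by ext v; simp [add_mul, Finset.sum_add_distrib]

theorem netFlow_apply (x : Fin m → ℤ) (v : Fin a) : netFlow src tgt x v =
    ∑ e, x e * ((if tgt e = v then 1 else 0) - if src e = v then 1 else 0) := rfl

theorem netFlow_single (e : Fin m) (c : ℤ) : netFlow src tgt (Pi.single e c) =
    Pi.single (tgt e) c - Pi.single (src e) c := by
  ext v
  rw [netFlow_apply, Finset.sum_eq_single e]
  · simp [Pi.single_apply, mul_sub, eq_comm]
  · intro f _ hf
    simp [hf]
  · simp

theorem sum_mul_netFlow (h : Fin a → ℤ) (x : Fin m → ℤ) :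
    ∑ v, h v * netFlow src tgt x v = ∑ e, x e * (h (tgt e) - h (src e)) := by
  simp only [netFlow_apply, Finset.mul_sum]
  rw [Finset.sum_comm]
  refine Finset.sum_congr rfl fun e _ => ?_
  have : ∀ v, h v * (x e * ((if tgt e = v then 1 else 0) - if src e = v then 1 else 0)) =
      (if tgt e = v then x e * h v else 0) - if src e = v then x e * h v else 0 := by
    intro v
    split_ifs <;> ring
  simp only [this, Finset.sum_sub_distrib, Finset.sum_ite_eq, Finset.mem_univ, if_true]
  ring

/-- The simple graph underlying the edges in `E`. -/
def edgeGraph (E : Finset (Fin m)) : SimpleGraph (Fin a) :=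
  SimpleGraph.fromRel fun u v => ∃ e ∈ E, src e = u ∧ tgt e = v

/-- One unit is sent along the path, with a minus sign on edges traversed against their orientation.
Recording the support shows that the edge prepended in the induction is not yet in use, since its
endpoint `u` is not on the rest of the path; so the values stay in $\{0,\pm1\}$. -/
theorem exists_flow_of_isPath {E : Finset (Fin m)} {u v : Fin a}
    (p : (edgeGraph src tgt E).Walk u v) (hp : p.IsPath) :
    ∃ δ : Fin m → ℤ, (∀ e, δ e = 0 ∨ δ e = 1 ∨ δ e = -1) ∧
      (∀ e, δ e ≠ 0 → e ∈ E ∧ src e ∈ p.support ∧ tgt e ∈ p.support) ∧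
      netFlow src tgt δ = Pi.single v 1 - Pi.single u 1 := by
  induction p with
  | nil => exact ⟨0, by simp, by simp, by simp⟩
  | @cons u w v hadj p ih =>
    rw [SimpleGraph.Walk.cons_isPath_iff] at hp
    obtain ⟨δ, h1, h2, h3⟩ := ih hp.1
    have key : ∀ e ∈ E, ∀ c : ℤ, (c = 1 ∨ c = -1) → (src e = u ∧ tgt e = w ∨ src e = w ∧ tgt e = u) →
        Pi.single (tgt e) c - Pi.single (src e) c = (Pi.single w 1 - Pi.single u 1 : Fin a → ℤ) →
        ∃ δ : Fin m → ℤ, (∀ e, δ e = 0 ∨ δ e = 1 ∨ δ e = -1) ∧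
        (∀ e, δ e ≠ 0 → e ∈ E ∧ src e ∈ (SimpleGraph.Walk.cons hadj p).support ∧
          tgt e ∈ (SimpleGraph.Walk.cons hadj p).support) ∧
        netFlow src tgt δ = Pi.single v 1 - Pi.single u 1 := by
      intro e he c hc hends hflow
      have hw : w ∈ p.support := p.start_mem_support
      have hδ : δ e = 0 := by
        by_contra hne
        obtain ⟨-, hs, ht⟩ := h2 e hne
        rcases hends with ⟨h, -⟩ | ⟨-, h⟩
        · exact hp.2 (h ▸ hs)
        · exact hp.2 (h ▸ ht)
      refine ⟨δ + Pi.single e c, fun f => ?_, fun f hf => ?_, ?_⟩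
      · by_cases hfe : f = e
        · subst hfe
          simp only [Pi.add_apply, hδ, Pi.single_eq_same, zero_add]
          tauto
        · simpa [hfe] using h1 f
      · simp only [SimpleGraph.Walk.support_cons, List.mem_cons]
        by_cases hfe : f = e
        · subst hfe
          refine ⟨he, ?_⟩
          rcases hends with ⟨h, h'⟩ | ⟨h, h'⟩ <;> simp [h, h', hw]
        · have := h2 f (by simpa [hfe] using hf)
          tauto
      · rw [map_add, h3, netFlow_single, hflow]
        abel
    rw [edgeGraph, SimpleGraph.fromRel_adj] at hadj
    obtain ⟨-, ⟨e, he, hs, ht⟩ | ⟨e, he, hs, ht⟩⟩ := id hadj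
    · exact key e he 1 (Or.inl rfl) (Or.inl ⟨hs, ht⟩) (by rw [hs, ht])
    · refine key e he (-1) (Or.inr rfl) (Or.inr ⟨hs, ht⟩) ?_
      rw [hs, ht, Pi.single_neg, Pi.single_neg]
      abel

/-- Either the edges in `E` carry a circulation with values `0`, `1`, `-1`, or the flow along them
is determined by its net inflow through integral linear forms. -/
theorem exists_circulation_or_dual (E : Finset (Fin m)) :
    (∃ δ : Fin m → ℤ, (∀ e, δ e = 0 ∨ δ e = 1 ∨ δ e = -1) ∧ (∀ e ∉ E, δ e = 0) ∧
      (∃ e ∈ E, δ e ≠ 0) ∧ netFlow src tgt δ = 0) ∨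
    ∃ φ : Fin m → Fin a → ℤ, ∀ e ∈ E, ∀ x : Fin m → ℤ, (∀ f ∉ E, x f = 0) →
      ∑ v, φ e v * netFlow src tgt x v = x e := by
  classical
  -- Either some edge closes a cycle with other edges of `E`, or every edge of `E` is a bridge and
  -- `E` is a forest.
  by_cases hE : ∃ e ∈ E, (edgeGraph src tgt (E.erase e)).Reachable (src e) (tgt e)
  · left
    obtain ⟨e, he, hreach⟩ := hE
    obtain ⟨p, hp⟩ := hreach.exists_isPath
    obtain ⟨δ, h1, h2, h3⟩ := exists_flow_of_isPath src tgt p hp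
    have hδ : δ e = 0 := by
      by_contra hne
      simpa using (h2 e hne).1
    refine ⟨δ - Pi.single e 1, fun f => ?_, fun f hf => ?_, ⟨e, he, by simp [hδ]⟩, ?_⟩
    · by_cases hfe : f = e
      · subst hfe
        simp [hδ]
      · simpa [hfe] using h1 f
    · have hfe : f ≠ e := fun h => hf (h ▸ he)
      have : δ f = 0 := by
        by_contra hne
        exact hf (Finset.mem_of_mem_erase (h2 f hne).1)
      simp [hfe, this]
    · rw [map_sub, h3, netFlow_single, sub_self]
  · right
    push Not at hE
    -- Removing the bridge `e` separates its endpoints. The net inflow into the component of `tgt e`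
    -- is the flow through `e`, because no other edge of `E` leaves that component.
    refine ⟨fun e v => if (edgeGraph src tgt (E.erase e)).Reachable v (tgt e) then 1 else 0,
      fun e he x hx => ?_⟩
    rw [sum_mul_netFlow, Finset.sum_eq_single e]
    · beta_reduce
      rw [if_pos (SimpleGraph.Reachable.refl _), if_neg (hE e he)]
      ring
    · intro f _ hfe
      by_cases hf : f ∈ E
      · have : (edgeGraph src tgt (E.erase e)).Reachable (tgt f) (tgt e) ↔
            (edgeGraph src tgt (E.erase e)).Reachable (src f) (tgt e) := by
          by_cases hloop : src f = tgt f
          · rw [hloop]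
          have hadj : (edgeGraph src tgt (E.erase e)).Adj (src f) (tgt f) := by
            rw [edgeGraph, SimpleGraph.fromRel_adj]
            exact ⟨hloop, Or.inl ⟨f, Finset.mem_erase.2 ⟨hfe, hf⟩, rfl, rfl⟩⟩
          exact ⟨hadj.reachable.trans, hadj.symm.reachable.trans⟩
        simp [this]
      · simp [hx f hf]
    · simp

/-- The integral flows with net inflow `d` that are bounded below by `c` on `E` and agree with `c`
outside `E`. -/
def flowFiber (E : Finset (Fin m)) (c : Fin m → ℤ) (d : Fin a → ℤ) : Set (Fin m → ℤ) :=
  {x | (∀ e ∈ E, c e ≤ x e) ∧ (∀ e ∉ E, x e = c e) ∧ netFlow src tgt x = d}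

variable {src tgt}

/-- Pair the net inflow of `x - c` with the vertex numbers. Every edge increases the number by at
least one, so the result is a sum of non-negative terms, the one at `e` being at least `x e - c e`.
Acyclicity thus makes the fibres finite. -/
theorem le_of_mem_flowFiber (hlt : ∀ e, src e < tgt e) {E : Finset (Fin m)}
    {c : Fin m → ℤ} {d : Fin a → ℤ} {x : Fin m → ℤ} (hx : x ∈ flowFiber src tgt E c d) (e : Fin m) :
    x e ≤ c e + ∑ v : Fin a, ((v : ℕ) : ℤ) * (d v - netFlow src tgt c v) := by
  obtain ⟨h1, h2, h3⟩ := hx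
  have hc : ∀ f, 0 ≤ x f - c f := by
    intro f
    by_cases hf : f ∈ E
    · linarith [h1 f hf]
    · rw [h2 f hf, sub_self]
  have hpos : ∀ f, (1 : ℤ) ≤ ((tgt f : ℕ) : ℤ) - ((src f : ℕ) : ℤ) := by
    intro f
    have : (src f : ℕ) < tgt f := hlt f
    omega
  have key := sum_mul_netFlow src tgt (fun v => ((v : ℕ) : ℤ)) (x - c)
  rw [map_sub, h3] at key
  simp only [Pi.sub_apply] at key
  rw [key]
  have hterm : ∀ f ∈ Finset.univ, 0 ≤ (x f - c f) * (((tgt f : ℕ) : ℤ) - ((src f : ℕ) : ℤ)) :=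
    fun f _ => mul_nonneg (hc f) (by linarith [hpos f])
  have := Finset.single_le_sum hterm (Finset.mem_univ e)
  nlinarith [hc e, hpos e]

theorem finite_flowFiber (hlt : ∀ e, src e < tgt e) (E : Finset (Fin m)) (c : Fin m → ℤ)
    (d : Fin a → ℤ) : (flowFiber src tgt E c d).Finite := by
  refine (Set.finite_Icc c (fun e => c e +
    ∑ v : Fin a, ((v : ℕ) : ℤ) * (d v - netFlow src tgt c v))).subset fun x hx =>
    ⟨fun e => ?_, le_of_mem_flowFiber hlt hx⟩
  by_cases he : e ∈ E
  · exact hx.1 e he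
  · rw [hx.2.1 e he]

variable (hlt : ∀ e, src e < tgt e)

/-- Raise the lower bound by one at the elements of `B` before `j`. -/
def raise (c : Fin m → ℤ) (B : Finset (Fin m)) (j : Fin m) : Fin m → ℤ :=
  fun e => if e ∈ B ∧ e < j then c e + 1 else c e

/-- For integral flows, missing the lower bound `c i` means being at least `c i + 1`. Hence the
flows for which `j` is the first edge of `B` with a tight bound form a fibre of the same kind, with
one free edge fewer. -/
theorem mem_flowFiber_raise {E B : Finset (Fin m)} (hB : B ⊆ E) {c : Fin m → ℤ} {d : Fin a → ℤ}
    {j : Fin m} (hj : j ∈ B) {x : Fin m → ℤ} :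
    x ∈ flowFiber src tgt (E.erase j) (raise c B j) d ↔
      x ∈ flowFiber src tgt E c d ∧ x j = c j ∧ ∀ i ∈ B, i < j → x i ≠ c i := by
  simp only [flowFiber, Set.mem_ofPred_eq, Finset.mem_erase, raise]
  constructor
  · rintro ⟨h1, h2, h3⟩
    have hj' : x j = c j := by simpa using h2 j (by simp)
    refine ⟨⟨fun e he => ?_, fun e he => ?_, h3⟩, hj', fun i hi hij => ?_⟩
    · by_cases hej : e = j
      · rw [hej, hj']
      · have := h1 e ⟨hej, he⟩
        split_ifs at this <;> omega
    · have := h2 e (fun h => he h.2)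
      rwa [if_neg (fun h => he (hB h.1))] at this
    · have := h1 i ⟨hij.ne, hB hi⟩
      rw [if_pos ⟨hi, hij⟩] at this
      omega
  · rintro ⟨⟨h1, h2, h3⟩, h4, h5⟩
    refine ⟨fun e he => ?_, fun e he => ?_, h3⟩
    · have := h1 e he.2
      split_ifs with h
      · have := h5 e h.1 h.2
        omega
      · exact this
    · by_cases hej : e = j
      · subst hej
        simpa using h4
      · have heE : e ∉ E := fun h => he ⟨hej, h⟩
        rw [if_neg (fun h => heE (hB h.1)), h2 e heE]

-- The flows with a tight bound in `B` are partitioned according to the first tight edge. This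
-- avoids inclusion–exclusion over intersecting faces.
open Classical in
theorem sum_flowFiber_boundary {E B : Finset (Fin m)} (hB : B ⊆ E) (c : Fin m → ℤ)
    (d : Fin a → ℤ) (f : (Fin m → ℤ) → ℚ) :
    ∑ x ∈ (finite_flowFiber hlt E c d).toFinset with ∃ j ∈ B, x j = c j, f x =
      ∑ j ∈ B, ∑ x ∈ (finite_flowFiber hlt (E.erase j) (raise c B j) d).toFinset, f x := by
  rw [← Finset.sum_biUnion]
  · refine Finset.sum_congr ?_ fun _ _ => rfl
    ext x
    simp only [Finset.mem_filter, Set.Finite.mem_toFinset, Finset.mem_biUnion]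
    constructor
    · rintro ⟨hx, hex⟩
      have hne : (B.filter fun j => x j = c j).Nonempty := by
        obtain ⟨j, hj, hxj⟩ := hex
        exact ⟨j, Finset.mem_filter.2 ⟨hj, hxj⟩⟩
      have hmin := Finset.mem_filter.1 (Finset.min'_mem _ hne)
      refine ⟨_, hmin.1, (mem_flowFiber_raise hB hmin.1).2 ⟨hx, hmin.2, fun i hi hlt' hxi => ?_⟩⟩
      exact absurd (Finset.min'_le _ i (Finset.mem_filter.2 ⟨hi, hxi⟩)) (not_le.2 hlt')
    · rintro ⟨j, hj, hx⟩
      rw [mem_flowFiber_raise hB hj] at hx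
      exact ⟨hx.1, j, hj, hx.2.1⟩
  · intro i hi j hj hij
    rw [Function.onFun, Finset.disjoint_left]
    intro x hxi hxj
    rw [Set.Finite.mem_toFinset, mem_flowFiber_raise hB hi] at hxi
    rw [Set.Finite.mem_toFinset, mem_flowFiber_raise hB hj] at hxj
    rcases lt_or_gt_of_ne hij with h | h
    · exact hxj.2.2 i hi h hxi.2.1
    · exact hxi.2.2 j hj h hxj.2.1

-- Telescoping along `δ`: the sums of `F x` and of `F (x - δ)` over the fibre cancel except at
-- points where the translate leaves the fibre, and these lie on the faces described by
-- `sum_flowFiber_boundary`.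
open Classical in
theorem sum_flowFiber_of_circulation {E : Finset (Fin m)} {δ : Fin m → ℤ}
    (h1 : ∀ e, δ e = 0 ∨ δ e = 1 ∨ δ e = -1) (h2 : ∀ e ∉ E, δ e = 0)
    (h3 : netFlow src tgt δ = 0) (c : Fin m → ℤ) (d : Fin a → ℤ) (f F : (Fin m → ℤ) → ℚ)
    (hF : ∀ x, F x - F (x - δ) = f x) :
    ∑ x ∈ (finite_flowFiber hlt E c d).toFinset, f x =
      (∑ j ∈ E with δ j = -1,
        ∑ x ∈ (finite_flowFiber hlt (E.erase j) (raise c {j ∈ E | δ j = -1} j) d).toFinset, F x) -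
      ∑ j ∈ E with δ j = 1,
        ∑ x ∈ (finite_flowFiber hlt (E.erase j) (raise c {j ∈ E | δ j = 1} j) d).toFinset,
          F (x - δ) := by
  rw [← sum_flowFiber_boundary hlt (Finset.filter_subset _ _) c d F,
    ← sum_flowFiber_boundary hlt (Finset.filter_subset _ _) c d fun x => F (x - δ)]
  set X := (finite_flowFiber hlt E c d).toFinset with hX
  have hmem : ∀ x, x ∈ X ↔ x ∈ flowFiber src tgt E c d := fun x => by rw [hX, Set.Finite.mem_toFinset]
  -- A step of size one can violate a lower bound only where that bound is attained; this is where
  -- the values $0,\pm1$ of `δ` matter.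
  have hadd : ∀ x ∈ X, x + δ ∉ X ↔ ∃ j ∈ E.filter (fun j => δ j = -1), x j = c j := by
    intro x hx
    rw [hmem] at hx ⊢
    obtain ⟨k1, k2, k3⟩ := hx
    rw [← not_iff_not, not_not]
    constructor
    · rintro ⟨l1, -, -⟩ ⟨j, hj, hxj⟩
      rw [Finset.mem_filter] at hj
      have := l1 j hj.1
      rw [Pi.add_apply, hj.2] at this
      omega
    · intro hne
      refine ⟨fun e he => ?_, fun e he => by rw [Pi.add_apply, h2 e he, k2 e he, add_zero], by
        rw [map_add, h3, k3, add_zero]⟩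
      have := k1 e he
      rw [Pi.add_apply]
      rcases h1 e with h | h | h
      · omega
      · omega
      · have : x e ≠ c e := fun hxe => hne ⟨e, Finset.mem_filter.2 ⟨he, h⟩, hxe⟩
        omega
  have hsub : ∀ x ∈ X, x - δ ∉ X ↔ ∃ j ∈ E.filter (fun j => δ j = 1), x j = c j := by
    intro x hx
    rw [hmem] at hx ⊢
    obtain ⟨k1, k2, k3⟩ := hx
    rw [← not_iff_not, not_not]
    constructor
    · rintro ⟨l1, -, -⟩ ⟨j, hj, hxj⟩
      rw [Finset.mem_filter] at hj
      have := l1 j hj.1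
      rw [Pi.sub_apply, hj.2] at this
      omega
    · intro hne
      refine ⟨fun e he => ?_, fun e he => by rw [Pi.sub_apply, h2 e he, k2 e he, sub_zero], by
        rw [map_sub, h3, k3, sub_zero]⟩
      have := k1 e he
      rw [Pi.sub_apply]
      rcases h1 e with h | h | h
      · omega
      · have : x e ≠ c e := fun hxe => hne ⟨e, Finset.mem_filter.2 ⟨he, h⟩, hxe⟩
        omega
      · omega
  have e1 : X.filter (fun x => ∃ j ∈ E.filter (fun j => δ j = -1), x j = c j) =
      X.filter fun x => x + δ ∉ X :=
    Finset.filter_congr fun x hx => (hadd x hx).symm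
  have e2 : X.filter (fun x => ∃ j ∈ E.filter (fun j => δ j = 1), x j = c j) =
      X.filter fun x => x - δ ∉ X :=
    Finset.filter_congr fun x hx => (hsub x hx).symm
  rw [e1, e2]
  have s1 := Finset.sum_filter_add_sum_filter_not X (fun x => x + δ ∈ X) F
  have s2 := Finset.sum_filter_add_sum_filter_not X (fun x => x - δ ∈ X) fun x => F (x - δ)
  have s3 : ∑ x ∈ X with x + δ ∈ X, F x = ∑ x ∈ X with x - δ ∈ X, F (x - δ) := by
    refine Finset.sum_nbij' (fun x => x + δ) (fun x => x - δ) ?_ ?_ ?_ ?_ ?_ <;> simp +contextual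
  have s4 : ∑ x ∈ X, f x = ∑ x ∈ X, F x - ∑ x ∈ X, F (x - δ) := by
    rw [← Finset.sum_sub_distrib]
    exact Finset.sum_congr rfl fun x _ => (hF x).symm
  rw [s4, ← s1, ← s2, s3]
  ring

variable {ι : Type*} [Fintype ι] {S : Set (ι → ℕ+)}

-- By duality the fibre has at most one point, and this candidate `ξ w` is affine in `w`. Whether it
-- does lie in the fibre is decided by signs of affine forms, so the sum is an indicator times a
-- polynomial in `ξ w`.
open Classical in
theorem isPiecewisePoly_sum_flowFiber_of_dual {E : Finset (Fin m)} {φ : Fin m → Fin a → ℤ}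
    (hφ : ∀ e ∈ E, ∀ x : Fin m → ℤ, (∀ f ∉ E, x f = 0) →
      ∑ v, φ e v * netFlow src tgt x v = x e)
    (c : Fin m → ℤ) {d : (ι → ℕ+) → Fin a → ℤ} (hd : ∀ v, IsAffineOn S fun w => (d w v : ℚ))
    (q : MvPolynomial (Fin m) ℚ) :
    IsPiecewisePoly S fun w => ∑ x ∈ (finite_flowFiber hlt E c (d w)).toFinset,
      MvPolynomial.eval (fun e => (x e : ℚ)) q := by
  -- Subtracting the fixed part `b` leaves a flow supported on `E`, to which `hφ` applies.
  let b : Fin m → ℤ := fun e => if e ∈ E then 0 else c e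
  let ξ : (ι → ℕ+) → Fin m → ℤ := fun w e =>
    if e ∈ E then ∑ v, φ e v * (d w v - netFlow src tgt b v) else c e
  have hξ : ∀ e, IsAffineOn S fun w => (ξ w e : ℚ) := by
    intro e
    by_cases he : e ∈ E
    · simp only [ξ, if_pos he]
      push_cast
      exact IsAffineOn.sum _ fun v _ => ((hd v).sub (IsAffineOn.const _)).const_mul _
    · simp only [ξ, if_neg he]
      exact IsAffineOn.const _
  have huniq : ∀ w x, x ∈ flowFiber src tgt E c (d w) → x = ξ w := by
    rintro w x ⟨-, h2, h3⟩
    ext e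
    by_cases he : e ∈ E
    · simp only [ξ, if_pos he]
      have := hφ e he (x - b) fun f hf => by simp [b, hf, h2 f hf]
      rw [map_sub, h3] at this
      simp only [Pi.sub_apply, b, if_pos he, sub_zero] at this
      exact this.symm
    · simp only [ξ, if_neg he, h2 e he]
  -- The net inflow of `ξ w` has to be tested as well: the prescribed inflow need not be attained by
  -- any flow of this shape.
  have hmem : ∀ w, ξ w ∈ flowFiber src tgt E c (d w) ↔
      (∀ e ∈ E, (0 : ℚ) ≤ (ξ w e : ℚ) - c e) ∧
        ∀ v ∈ Finset.univ, (∑ e, (ξ w e : ℚ) *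
          ((if tgt e = v then 1 else 0) - if src e = v then 1 else 0)) - (d w v : ℚ) = 0 := by
    intro w
    have hout : ∀ e ∉ E, ξ w e = c e := fun e he => by simp only [ξ, if_neg he]
    simp only [flowFiber, Set.mem_ofPred_eq, sub_nonneg, Int.cast_le, Finset.mem_univ, true_implies,
      sub_eq_zero, funext_iff, netFlow_apply]
    constructor
    · rintro ⟨h1, -, h3⟩
      refine ⟨h1, fun v => ?_⟩
      rw [← h3 v]
      push_cast
      rfl
    · rintro ⟨h1, h3⟩
      refine ⟨h1, hout, fun v => ?_⟩
      have := h3 v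
      exact_mod_cast this
  have hind : IsPiecewisePoly S fun w => if ξ w ∈ flowFiber src tgt E c (d w) then 1 else 0 := by
    refine (IsPiecewisePoly.indicator_and (.indicator_forall E fun e _ =>
      .indicator_nonneg ((hξ e).sub (.const (c e : ℚ)))) (.indicator_forall Finset.univ fun v _ =>
        .indicator_eq_zero (.sub (.sum Finset.univ fun e _ => ?_) (hd v)))).congr
          fun w _ => if_congr (hmem w) rfl rfl
    simp only [mul_comm]
    exact (hξ e).const_mul _
  refine (hind.mul (.eval q fun e => .of_isAffineOn (hξ e))).congr fun w _ => ?_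
  split_ifs with h
  · rw [one_mul]
    refine Finset.sum_eq_single_of_mem _ ((Set.Finite.mem_toFinset _).2 h) fun x hx hne => ?_
    exact absurd (huniq w x ((Set.Finite.mem_toFinset _).1 hx)) hne
  · rw [zero_mul]
    refine Finset.sum_eq_zero fun x hx => ?_
    have hx' := (Set.Finite.mem_toFinset _).1 hx
    exact absurd (huniq w x hx' ▸ hx') h

/-- Sums of a polynomial over the flows with prescribed net inflow are piecewise polynomial in the
inflow. -/
theorem isPiecewisePoly_sum_flowFiber (E : Finset (Fin m)) (c : Fin m → ℤ)
    {d : (ι → ℕ+) → Fin a → ℤ} (hd : ∀ v, IsAffineOn S fun w => (d w v : ℚ))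
    (q : MvPolynomial (Fin m) ℚ) :
    IsPiecewisePoly S fun w => ∑ x ∈ (finite_flowFiber hlt E c (d w)).toFinset,
      MvPolynomial.eval (fun e => (x e : ℚ)) q := by
  classical
  -- Passing to a face fixes one edge, raises some bounds and replaces the polynomial, but leaves
  -- the inflow `d` unchanged.
  induction hn : E.card generalizing E c q with
  | zero =>
    rw [Finset.card_eq_zero] at hn
    subst hn
    exact isPiecewisePoly_sum_flowFiber_of_dual hlt (φ := 0) (by simp) c hd q
  | succ n ih =>
    rcases exists_circulation_or_dual src tgt E with ⟨δ, h1, h2, ⟨e, he, hne⟩, h3⟩ | ⟨φ, hφ⟩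
    · obtain ⟨Q, hQ⟩ := exists_antidifference (fun e => (δ e : ℚ)) (e := e) (by exact_mod_cast hne) q
      have hQ' : ∀ x : Fin m → ℤ, MvPolynomial.eval (fun e => (x e : ℚ)) Q -
          MvPolynomial.eval (fun e => ((x - δ) e : ℚ)) Q =
          MvPolynomial.eval (fun e => (x e : ℚ)) q := by
        intro x
        rw [← hQ]
        congr 3
        ext e
        simp
      -- `Q` precomposed with the translation by `-δ`, so that the second boundary term is again a
      -- polynomial sum.
      let Q' : MvPolynomial (Fin m) ℚ :=
        MvPolynomial.bind₁ (fun e => MvPolynomial.X e - MvPolynomial.C (δ e : ℚ)) Q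
      have hbind : ∀ x : Fin m → ℤ, MvPolynomial.eval (fun e => ((x - δ) e : ℚ)) Q =
          MvPolynomial.eval (fun e => (x e : ℚ)) Q' := by
        intro x
        simp only [Q', ← MvPolynomial.coe_aeval_eq_eval, RingHom.coe_coe, MvPolynomial.aeval_bind₁]
        simp
      simp only [sum_flowFiber_of_circulation hlt h1 h2 h3 c _ _
        (fun x => MvPolynomial.eval (fun e => (x e : ℚ)) Q) (fun x => hQ' x), hbind]
      refine .sub (.sum _ fun j hj => ih _ _ _ ?_) (.sum _ fun j hj => ih _ _ _ ?_) <;>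
      · rw [Finset.card_erase_of_mem (Finset.mem_filter.1 hj).1, hn, Nat.add_sub_cancel]
    · exact isPiecewisePoly_sum_flowFiber_of_dual hlt hφ c hd q

end Flow

/-! ### Equivalence of markings as a free permutation action -/

namespace FloorDiagram

variable {a : ℕ} {D : FloorDiagram a} {lr ll k : ℕ} {w : EndWeights lr ll}

namespace MarkedVertex

/-- The vertices of a marked floor diagram whose edges are labelled by `T`. -/
def sumEquiv {T : Type*} (β : T ≃ D.edges.ToType) :
    Fin a ⊕ T ⊕ Fin lr ⊕ Fin ll ≃ D.MarkedVertex lr ll where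
  toFun
    | .inl v => white v
    | .inr (.inl e) => edge (β e)
    | .inr (.inr (.inl j)) => right j
    | .inr (.inr (.inr i)) => left i
  invFun
    | white v => .inl v
    | edge e => .inr (.inl (β.symm e))
    | right j => .inr (.inr (.inl j))
    | left i => .inr (.inr (.inr i))
  left_inv := by rintro (v | e | j | i) <;> simp
  right_inv := by rintro (v | e | j | i) <;> simp

instance : Finite (D.MarkedVertex lr ll) := Finite.of_equiv _ (sumEquiv (Equiv.refl _))

/-- The permutation of the vertices induced by permutations of the edges and of the ends. -/
def perm (τ : Equiv.Perm D.edges.ToType) (πr : Equiv.Perm (Fin lr)) (πl : Equiv.Perm (Fin ll)) :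
    Equiv.Perm (D.MarkedVertex lr ll) where
  toFun
    | white v => white v
    | edge e => edge (τ e)
    | right j => right (πr j)
    | left i => left (πl i)
  invFun
    | white v => white v
    | edge e => edge (τ.symm e)
    | right j => right (πr.symm j)
    | left i => left (πl.symm i)
  left_inv := by rintro (v | e | j | i) <;> simp
  right_inv := by rintro (v | e | j | i) <;> simp

end MarkedVertex

open MarkedVertex

theorem MarkedArc.of_white_left {ρ : Fin lr → Fin a} {l : Fin ll → Fin a} {v : Fin a}
    {x : D.MarkedVertex lr ll} {n : ℕ+} (h : D.MarkedArc w ρ l (.white v) x n) :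
    (∃ e : D.edges.ToType, x = .edge e ∧ e.1.src = v ∧ e.1.weight = n) ∨
      ∃ j, x = .right j ∧ ρ j = v ∧ w (Sum.inl j) = n := by
  cases h with
  | firstHalf e => exact Or.inl ⟨e, rfl, rfl, rfl⟩
  | right j => exact Or.inr ⟨j, rfl, rfl, rfl⟩

theorem MarkedArc.of_white_right {ρ : Fin lr → Fin a} {l : Fin ll → Fin a} {v : Fin a}
    {x : D.MarkedVertex lr ll} {n : ℕ+} (h : D.MarkedArc w ρ l x (.white v) n) :
    (∃ e : D.edges.ToType, x = .edge e ∧ e.1.tgt = v ∧ e.1.weight = n) ∨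
      ∃ i, x = .left i ∧ l i = v ∧ w (Sum.inr i) = n := by
  cases h with
  | secondHalf e => exact Or.inl ⟨e, rfl, rfl, rfl⟩
  | left i => exact Or.inr ⟨i, rfl, rfl, rfl⟩

section Isomorphisms

variable {ρ ρ' : Fin lr → Fin a} {l l' : Fin ll → Fin a}
  {σ : D.MarkedVertex lr ll ≃ D.MarkedVertex lr ll}

/-- A black vertex on an edge has both an arc from a white vertex and an arc to one, whereas the tip
of an end has only one of the two. The two arcs also determine source, target and weight. -/
theorem exists_map_edge (hw : ∀ v, σ (.white v) = .white v)
    (h : ∀ x y n, D.MarkedArc w ρ l x y n → D.MarkedArc w ρ' l' (σ x) (σ y) n)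
    (e : D.edges.ToType) : ∃ e' : D.edges.ToType, σ (.edge e) = .edge e' ∧ e'.1 = e.1 := by
  have h1 := h _ _ _ (.firstHalf e)
  have h2 := h _ _ _ (.secondHalf e)
  rw [hw] at h1 h2
  rcases h1.of_white_left with ⟨e', he', h3, h4⟩ | ⟨j, hj, -⟩
  · rcases h2.of_white_right with ⟨e'', he'', h5, -⟩ | ⟨i, hi, -⟩
    · obtain rfl : e' = e'' := by
        rw [he'] at he''
        exact MarkedVertex.edge.inj he''
      exact ⟨e', he', FloorEdge.ext h3 h5 h4⟩
    · rw [he'] at hi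
      cases hi
  · rcases h2.of_white_right with ⟨e'', he'', -⟩ | ⟨i, hi, -⟩
    · rw [hj] at he''
      cases he''
    · rw [hj] at hi
      cases hi

/-- This prevents the tip of an end from being sent to a vertex on an edge. -/
theorem exists_map_edge_symm (hw : ∀ v, σ (.white v) = .white v)
    (h : ∀ x y n, D.MarkedArc w ρ l x y n ↔ D.MarkedArc w ρ' l' (σ x) (σ y) n)
    (e : D.edges.ToType) :
    ∃ e' : D.edges.ToType, σ.symm (.edge e) = .edge e' := by
  obtain ⟨e', he', -⟩ := exists_map_edge (σ := σ.symm)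
    (fun v => by rw [Equiv.symm_apply_eq, hw]) (w := w) (ρ := ρ') (ρ' := ρ) (l := l') (l' := l)
    (fun x y n hxy => by rw [h]; simpa using hxy) e
  exact ⟨e', he'⟩

theorem exists_map_right (hw : ∀ v, σ (.white v) = .white v)
    (h : ∀ x y n, D.MarkedArc w ρ l x y n ↔ D.MarkedArc w ρ' l' (σ x) (σ y) n)
    (j : Fin lr) :
    ∃ j', σ (.right j) = .right j' ∧ w (Sum.inl j') = w (Sum.inl j) ∧ ρ' j' = ρ j := by
  have h1 := (h _ _ _).1 (.right j)
  rw [hw] at h1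
  rcases h1.of_white_left with ⟨e, he, -⟩ | ⟨j', hj', h2, h3⟩
  · obtain ⟨e', he'⟩ := exists_map_edge_symm hw h e
    rw [← he, Equiv.symm_apply_apply] at he'
    cases he'
  · exact ⟨j', hj', h3, h2⟩

theorem exists_map_left (hw : ∀ v, σ (.white v) = .white v)
    (h : ∀ x y n, D.MarkedArc w ρ l x y n ↔ D.MarkedArc w ρ' l' (σ x) (σ y) n)
    (i : Fin ll) :
    ∃ i', σ (.left i) = .left i' ∧ w (Sum.inr i') = w (Sum.inr i) ∧ l' i' = l i := by
  have h1 := (h _ _ _).1 (.left i)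
  rw [hw] at h1
  rcases h1.of_white_right with ⟨e, he, -⟩ | ⟨i', hi', h2, h3⟩
  · obtain ⟨e', he'⟩ := exists_map_edge_symm hw h e
    rw [← he, Equiv.symm_apply_apply] at he'
    cases he'
  · exact ⟨i', hi', h3, h2⟩

theorem exists_perm (hw : ∀ v, σ (.white v) = .white v)
    (h : ∀ x y n, D.MarkedArc w ρ l x y n ↔ D.MarkedArc w ρ' l' (σ x) (σ y) n)
    : ∃ (τ : Equiv.Perm D.edges.ToType) (πr : Equiv.Perm (Fin lr))
    (πl : Equiv.Perm (Fin ll)), (∀ e, (τ e).1 = e.1) ∧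
      (∀ j, w (Sum.inl (πr j)) = w (Sum.inl j)) ∧ (∀ i, w (Sum.inr (πl i)) = w (Sum.inr i)) ∧
      ρ' ∘ πr = ρ ∧ l' ∘ πl = l ∧ σ = perm τ πr πl := by
  choose f hf hf' using exists_map_edge hw fun x y n => (h x y n).1
  choose r hr hr' hr'' using exists_map_right hw h
  choose s hs hs' hs'' using exists_map_left hw h
  have bf : f.Bijective := Finite.injective_iff_bijective.1 fun x y hxy => by
    have := (hf x).trans ((congrArg _ hxy).trans (hf y).symm)
    exact MarkedVertex.edge.inj (σ.injective this)
  have br : r.Bijective := Finite.injective_iff_bijective.1 fun x y hxy => by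
    have := (hr x).trans ((congrArg _ hxy).trans (hr y).symm)
    exact MarkedVertex.right.inj (σ.injective this)
  have bs : s.Bijective := Finite.injective_iff_bijective.1 fun x y hxy => by
    have := (hs x).trans ((congrArg _ hxy).trans (hs y).symm)
    exact MarkedVertex.left.inj (σ.injective this)
  refine ⟨Equiv.ofBijective f bf, Equiv.ofBijective r br, Equiv.ofBijective s bs, hf', hr', hs',
    funext hr'', funext hs'', Equiv.ext ?_⟩
  rintro (v | e | j | i)
  · exact hw v
  · exact hf e
  · exact hr j
  · exact hs i

end Isomorphisms

theorem MarkedArc.perm {ρ : Fin lr → Fin a} {l : Fin ll → Fin a} {x y : D.MarkedVertex lr ll}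
    {n : ℕ+} (h : D.MarkedArc w ρ l x y n) {τ : Equiv.Perm D.edges.ToType}
    {πr : Equiv.Perm (Fin lr)} {πl : Equiv.Perm (Fin ll)} (hτ : ∀ e, (τ e).1 = e.1)
    (hr : ∀ j, w (Sum.inl (πr j)) = w (Sum.inl j)) (hl : ∀ i, w (Sum.inr (πl i)) = w (Sum.inr i)) :
    D.MarkedArc w (ρ ∘ πr.symm) (l ∘ πl.symm) (MarkedVertex.perm τ πr πl x)
      (MarkedVertex.perm τ πr πl y) n := by
  cases h with
  | firstHalf e =>
    rw [← hτ e]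
    exact .firstHalf (τ e)
  | secondHalf e =>
    rw [← hτ e]
    exact .secondHalf (τ e)
  | right j =>
    have := MarkedArc.right (D := D) (w := w) (rightSrc := ρ ∘ πr.symm)
      (leftTgt := l ∘ πl.symm) (πr j)
    rw [hr, Function.comp_apply, Equiv.symm_apply_apply] at this
    exact this
  | left i =>
    have := MarkedArc.left (D := D) (w := w) (rightSrc := ρ ∘ πr.symm)
      (leftTgt := l ∘ πl.symm) (πl i)
    rw [hl, Function.comp_apply, Equiv.symm_apply_apply] at this
    exact this

theorem symm_weights {ι κ : Type*} {f : ι → κ} {π : Equiv.Perm ι} (h : ∀ j, f (π j) = f j) (j : ι) :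
    f (π.symm j) = f j := by
  rw [← h, Equiv.apply_symm_apply]

theorem markedArc_perm_iff {ρ : Fin lr → Fin a} {l : Fin ll → Fin a} {x y : D.MarkedVertex lr ll}
    {n : ℕ+} {τ : Equiv.Perm D.edges.ToType}
    {πr : Equiv.Perm (Fin lr)} {πl : Equiv.Perm (Fin ll)} (hτ : ∀ e, (τ e).1 = e.1)
    (hr : ∀ j, w (Sum.inl (πr j)) = w (Sum.inl j)) (hl : ∀ i, w (Sum.inr (πl i)) = w (Sum.inr i)) :
    D.MarkedArc w ρ l x y n ↔ D.MarkedArc w (ρ ∘ πr.symm) (l ∘ πl.symm)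
      (MarkedVertex.perm τ πr πl x) (MarkedVertex.perm τ πr πl y) n := by
  refine ⟨fun h => h.perm hτ hr hl, fun h => ?_⟩
  have := h.perm (τ := τ.symm) (πr := πr.symm) (πl := πl.symm)
    (symm_weights (f := fun e : D.edges.ToType => e.1) hτ)
    (symm_weights (f := fun j => w (Sum.inl j)) hr) (symm_weights (f := fun j => w (Sum.inr j)) hl)
  have e : ∀ z : D.MarkedVertex lr ll, MarkedVertex.perm τ.symm πr.symm πl.symm
      (MarkedVertex.perm τ πr πl z) = z := (MarkedVertex.perm τ πr πl).symm_apply_apply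
  rw [e, e] at this
  simpa [Function.comp_assoc] using this

variable (D w) in
/-- The triples of a permutation of the edges of `D` and permutations of the right and left ends,
all of them preserving the weights. -/
abbrev WeightPerm : Type :=
  {τ : Equiv.Perm D.edges.ToType // ∀ e, (τ e).1 = e.1} ×
    {π : Equiv.Perm (Fin lr) // ∀ j, w (Sum.inl (π j)) = w (Sum.inl j)} ×
      {π : Equiv.Perm (Fin ll) // ∀ i, w (Sum.inr (π i)) = w (Sum.inr i)}

/-- The permutation of the vertices of marked diagrams induced by an element of `WeightPerm`. -/
def WeightPerm.perm (γ : D.WeightPerm w) : Equiv.Perm (D.MarkedVertex lr ll) :=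
  MarkedVertex.perm γ.1.1 γ.2.1.1 γ.2.2.1

theorem WeightPerm.perm_injective :
    Function.Injective (WeightPerm.perm : D.WeightPerm w → Equiv.Perm (D.MarkedVertex lr ll)) := by
  rintro ⟨⟨τ, h⟩, ⟨πr, hr⟩, ⟨πl, hl⟩⟩ ⟨⟨τ', h'⟩, ⟨πr', hr'⟩, ⟨πl', hl'⟩⟩ heq
  have e1 : τ = τ' := Equiv.ext fun e =>
    MarkedVertex.edge.inj (DFunLike.congr_fun heq (MarkedVertex.edge e))
  have e2 : πr = πr' := Equiv.ext fun e =>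
    MarkedVertex.right.inj (DFunLike.congr_fun heq (MarkedVertex.right e))
  have e3 : πl = πl' := Equiv.ext fun e =>
    MarkedVertex.left.inj (DFunLike.congr_fun heq (MarkedVertex.left e))
  subst e1 e2 e3
  rfl

theorem isStrictTotalOrder_comap {α β : Type*} {r : β → β → Prop} (h : IsStrictTotalOrder β r)
    {f : α → β} (hf : Function.Injective f) : IsStrictTotalOrder α fun x y => r (f x) (f y) where
  trichotomous _ _ h1 h2 := hf (h.trichotomous _ _ h1 h2)
  irrefl _ := h.irrefl _
  trans _ _ _ := h.trans _ _ _

theorem sum_comp_symm {ι : Type*} [Fintype ι] (π : Equiv.Perm ι) {f : ι → ℕ+}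
    (hf : ∀ j, f (π j) = f j) (p : ι → Fin a) (v : Fin a) :
    ∑ i with (p ∘ π.symm) i = v, ((f i : ℕ) : ℤ) = ∑ i with p i = v, ((f i : ℕ) : ℤ) := by
  rw [Finset.sum_filter, Finset.sum_filter]
  refine (Equiv.sum_comp π _).symm.trans (Finset.sum_congr rfl fun i _ => ?_)
  simp [hf]

namespace Marking

@[ext]
theorem ext' {m m' : D.Marking k w} (h1 : m.rightSrc = m'.rightSrc) (h2 : m.leftTgt = m'.leftTgt)
    (h3 : m.lt = m'.lt) : m = m' := by
  cases m
  cases m'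
  subst h1 h2 h3
  rfl

/-- Transport of a marking along a permutation of edges and ends. -/
def relabel (m : D.Marking k w) (γ : D.WeightPerm w) : D.Marking k w where
  rightSrc := m.rightSrc ∘ γ.2.1.1.symm
  leftTgt := m.leftTgt ∘ γ.2.2.1.symm
  div_eq v := by
    rw [← m.div_eq v, sum_comp_symm γ.2.1.1 (f := fun j => w (Sum.inl j)) γ.2.1.2,
      sum_comp_symm γ.2.2.1 (f := fun j => w (Sum.inr j)) γ.2.2.2]
  lt x y := m.lt (γ.perm.symm x) (γ.perm.symm y)
  isStrictTotalOrder := isStrictTotalOrder_comap m.isStrictTotalOrder γ.perm.symm.injective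
  white_lt_white u v := m.white_lt_white u v
  lt_of_arc x y n h := by
    refine m.lt_of_arc _ _ n ((markedArc_perm_iff γ.1.2 γ.2.1.2 γ.2.2.2).2 ?_)
    change D.MarkedArc w _ _ (γ.perm (γ.perm.symm x)) (γ.perm (γ.perm.symm y)) n
    rwa [Equiv.apply_symm_apply, Equiv.apply_symm_apply]

theorem equivalent_relabel (m : D.Marking k w) (γ : D.WeightPerm w) :
    m.Equivalent (m.relabel γ) :=
  ⟨γ.perm, fun _ => rfl, fun _ _ _ => markedArc_perm_iff γ.1.2 γ.2.1.2 γ.2.2.2,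
    fun x y => by simp [relabel]⟩

/-- The action is free: two relabellings with the same result differ by an automorphism of a finite
total order, which is the identity. -/
theorem relabel_injective (m : D.Marking k w) : Function.Injective m.relabel := by
  intro γ γ' h
  have := m.isStrictTotalOrder
  have wf : WellFounded m.lt := Finite.wellFounded_of_trans_of_irrefl m.lt
  have hlt : ∀ x y, m.lt (γ.perm.symm x) (γ.perm.symm y) ↔
      m.lt (γ'.perm.symm x) (γ'.perm.symm y) := fun x y =>
    iff_of_eq (congrFun (congrFun (congrArg Marking.lt h) x) y)
  let θ : m.lt ≃r m.lt := ⟨γ.perm.trans γ'.perm.symm, fun {x y} => by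
    have := hlt (γ.perm x) (γ.perm y)
    simpa using this.symm⟩
  have : IsWellOrder _ m.lt := { wf := wf }
  have hθ : θ.toInitialSeg = (RelIso.refl m.lt).toInitialSeg := Subsingleton.elim _ _
  refine WeightPerm.perm_injective (Equiv.ext fun x => ?_)
  have := DFunLike.congr_fun hθ x
  change γ'.perm.symm (γ.perm x) = x at this
  rw [← this, Equiv.apply_symm_apply, this]

theorem exists_eq_relabel {m m' : D.Marking k w} (h : m.Equivalent m') :
    ∃ γ, m' = m.relabel γ := by
  obtain ⟨σ, h1, h2, h3⟩ := h
  obtain ⟨τ, πr, πl, hτ, hr, hl, hρ, hl', rfl⟩ := exists_perm h1 h2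
  refine ⟨⟨⟨τ, hτ⟩, ⟨πr, hr⟩, ⟨πl, hl⟩⟩, ext' ?_ ?_ ?_⟩
  · simp [relabel, ← hρ, Function.comp_assoc]
  · simp [relabel, ← hl', Function.comp_assoc]
  · funext x y
    have := h3 ((MarkedVertex.perm τ πr πl).symm x) ((MarkedVertex.perm τ πr πl).symm y)
    rw [Equiv.apply_symm_apply, Equiv.apply_symm_apply] at this
    exact (propext this).symm

end Marking

/-- The equivalence classes are the orbits of a free action, so each of them has as many elements as
the group. -/
theorem card_marking :
    Nat.card (D.Marking k w) = D.numMarkings k w * Nat.card (D.WeightPerm w) := by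
  rw [numMarkings, ← Nat.card_prod]
  refine (Nat.card_eq_of_bijective (fun p : Quotient (Marking.setoid (D := D) k w) ×
    D.WeightPerm w => p.1.out.relabel p.2) ⟨?_, ?_⟩).symm
  · rintro ⟨q, γ⟩ ⟨q', γ'⟩ h
    have hq : q = q' := by
      rw [← q.out_eq, ← q'.out_eq]
      refine Quotient.sound ((Marking.setoid k w).trans (q.out.equivalent_relabel γ) ?_)
      change q.out.relabel γ = q'.out.relabel γ' at h
      rw [h]
      exact (Marking.setoid k w).symm (q'.out.equivalent_relabel γ')
    subst hq
    have hγ : γ = γ' := Marking.relabel_injective _ h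
    rw [hγ]
  · intro m
    obtain ⟨γ, hγ⟩ := Marking.exists_eq_relabel (Quotient.exact (Quotient.out_eq (⟦m⟧ : Quotient
      (Marking.setoid (D := D) k w))))
    exact ⟨(⟦m⟧, γ), hγ.symm⟩

end FloorDiagram

/-! ### Labelled edges and combinatorial types -/

namespace FloorDiagram

variable {a m lr ll k : ℕ}

/-- The floor diagram with the given family of edges. -/
def ofEdges (E : Fin m → FloorEdge a) : FloorDiagram a := ⟨Finset.univ.val.map E⟩

/-- Over each edge type both sides have as many elements as its multiplicity in `D`; the bijections
of the fibres are glued together. -/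
theorem exists_labelling_of_map_eq {D : FloorDiagram a} {E : Fin m → FloorEdge a}
    (h : ofEdges E = D) : ∃ β : Fin m ≃ D.edges.ToType, ∀ i, (β i).1 = E i := by
  subst h
  have hcard : ∀ x : FloorEdge a, Nonempty ({i // E i = x} ≃
      {t : (ofEdges E).edges.ToType // t.1 = x}) := by
    intro x
    have h1 : Nat.card {i // E i = x} = (ofEdges E).edges.count x := by
      rw [Nat.card_eq_fintype_card, Fintype.card_subtype, ofEdges, Multiset.count_map]
      simp only [eq_comm]
      rfl
    have h2 : Nat.card {t : (ofEdges E).edges.ToType // t.1 = x} = (ofEdges E).edges.count x := by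
      rw [Nat.card_congr (β := Fin ((ofEdges E).edges.count x))]
      · simp
      · exact
          { toFun := fun t => Fin.cast (by rw [t.2]) t.1.2
            invFun := fun i => ⟨⟨x, i⟩, rfl⟩
            left_inv := by rintro ⟨⟨y, i⟩, rfl⟩; rfl
            right_inv := fun i => rfl }
    exact ⟨(Finite.equivFinOfCardEq h1).trans (Finite.equivFinOfCardEq h2).symm⟩
  exact ⟨Equiv.ofFiberEquiv (g := fun t : (ofEdges E).edges.ToType => t.1)
    fun x => (hcard x).some, Equiv.ofFiberEquiv_map _⟩

theorem ofEdges_of_labelling {D : FloorDiagram a} (β : Fin m ≃ D.edges.ToType) :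
    ofEdges (fun i => (β i).1) = D := by
  refine FloorDiagram.ext ?_
  conv_rhs => rw [← Multiset.map_univ_coe D.edges]
  change Multiset.map ((fun t : D.edges.ToType => t.1) ∘ β) Finset.univ.val = _
  rw [← Multiset.map_map, Multiset.map_univ_val_equiv]

variable {D : FloorDiagram a}

/-- Orbit–stabiliser for bijections from `Fin m` to the edges: such a bijection amounts to the
family it induces together with a permutation among identical edges, measured against the reference
labelling `β`. -/
theorem card_labellings (hD : Multiset.card D.edges = m) :
    Nat.card {E : Fin m → FloorEdge a // ofEdges E = D} *
      Nat.card {τ : Equiv.Perm D.edges.ToType // ∀ e, (τ e).1 = e.1} = m.factorial := by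
  have h0 : Nat.card (Fin m ≃ D.edges.ToType) = m.factorial := by
    have e : Fin m ≃ D.edges.ToType := Fintype.equivOfCardEq (by simp [hD])
    classical
    rw [Nat.card_eq_fintype_card, Fintype.card_equiv e, Fintype.card_fin]
  rw [← h0, ← Nat.card_prod]
  choose β hβ using fun E : {E : Fin m → FloorEdge a // ofEdges E = D} =>
    exists_labelling_of_map_eq E.2
  refine Nat.card_congr
    { toFun := fun p => (β p.1).trans p.2.1
      invFun := fun b => (⟨fun i => (b i).1, ofEdges_of_labelling b⟩,
        ⟨(β ⟨fun i => (b i).1, ofEdges_of_labelling b⟩).symm.trans b, fun e => ?_⟩)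
      left_inv := ?_
      right_inv := fun b => ?_ }
  · have := hβ ⟨fun i => (b i).1, ofEdges_of_labelling b⟩
      ((β ⟨fun i => (b i).1, ofEdges_of_labelling b⟩).symm e)
    rw [Equiv.apply_symm_apply] at this
    exact this.symm
  · rintro ⟨E, τ, hτ⟩
    have hE : (⟨fun i => (((β E).trans τ) i).1, ofEdges_of_labelling _⟩ :
        {E : Fin m → FloorEdge a // ofEdges E = D}) = E := by
      ext1
      funext i
      exact (hτ _).trans (hβ E i)
    refine Prod.ext hE (Subtype.ext (Equiv.ext fun e => ?_))
    simp only [hE]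
    simp
  · ext i
    simp

/-- The inflow which the edges have to provide at the white vertices when the ends are attached to
the white vertices in the prescribed way. -/
def requiredInflow (k : ℕ) (p : (Fin lr → Fin a) × (Fin ll → Fin a)) (w : EndWeights lr ll)
    (v : Fin a) : ℤ :=
  k - ∑ i with p.2 i = v, ((w (Sum.inr i) : ℕ) : ℤ) + ∑ j with p.1 j = v, ((w (Sum.inl j) : ℕ) : ℤ)

/-- Total orders on the vertices of a marked floor diagram with edges labelled by `Fin m`, compatible
with the orientation of all edges. -/
def IsMarkedOrder (s t : Fin m → Fin a) (p : (Fin lr → Fin a) × (Fin ll → Fin a))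
    (r : Fin a ⊕ Fin m ⊕ Fin lr ⊕ Fin ll → Fin a ⊕ Fin m ⊕ Fin lr ⊕ Fin ll → Prop) : Prop :=
  IsStrictTotalOrder _ r ∧ (∀ u v, r (.inl u) (.inl v) ↔ u < v) ∧
    (∀ e, r (.inl (s e)) (.inr (.inl e)) ∧ r (.inr (.inl e)) (.inl (t e))) ∧
    (∀ j, r (.inl (p.1 j)) (.inr (.inr (.inl j)))) ∧ ∀ i, r (.inr (.inr (.inr i))) (.inl (p.2 i))

/-- A marking amounts to an attachment of the ends together with a compatible total order. -/
def markingEquiv {w : EndWeights lr ll} {s t : Fin m → Fin a} (β : Fin m ≃ D.edges.ToType)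
    (hs : ∀ e, (β e).1.src = s e) (ht : ∀ e, (β e).1.tgt = t e) :
    D.Marking k w ≃ Σ p : {p : (Fin lr → Fin a) × (Fin ll → Fin a) //
      ∀ v, D.div v = requiredInflow k p w v}, {r // IsMarkedOrder s t p.1 r} where
  toFun M := ⟨⟨(M.rightSrc, M.leftTgt), fun v => by
      have := M.div_eq v
      rw [requiredInflow]
      linarith⟩,
    ⟨fun x y => M.lt (MarkedVertex.sumEquiv β x) (MarkedVertex.sumEquiv β y),
      isStrictTotalOrder_comap M.isStrictTotalOrder (MarkedVertex.sumEquiv β).injective,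
      M.white_lt_white, fun e => ⟨by
        have := M.lt_of_arc _ _ _ (.firstHalf (β e))
        rw [hs] at this
        exact this, by
        have := M.lt_of_arc _ _ _ (.secondHalf (β e))
        rw [ht] at this
        exact this⟩, fun j => M.lt_of_arc _ _ _ (.right j), fun i => M.lt_of_arc _ _ _ (.left i)⟩⟩
  invFun q :=
    { rightSrc := q.1.1.1
      leftTgt := q.1.1.2
      div_eq := fun v => by
        rw [q.1.2 v, requiredInflow]
        ring
      lt := fun x y => q.2.1 ((MarkedVertex.sumEquiv β).symm x) ((MarkedVertex.sumEquiv β).symm y)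
      isStrictTotalOrder :=
        isStrictTotalOrder_comap q.2.2.1 (MarkedVertex.sumEquiv β).symm.injective
      white_lt_white := q.2.2.2.1
      lt_of_arc := fun x y n h => by
        obtain ⟨p, r, h1, h2, h3, h4, h5⟩ := q
        cases h with
        | firstHalf e =>
          have := (h3 (β.symm e)).1
          rw [← hs, Equiv.apply_symm_apply] at this
          exact this
        | secondHalf e =>
          have := (h3 (β.symm e)).2
          rw [← ht, Equiv.apply_symm_apply] at this
          exact this
        | right j => exact h4 j
        | left i => exact h5 i }
  left_inv M := Marking.ext' rfl rfl (by simp)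
  right_inv q := by simp

theorem div_ofEdges (E : Fin m → FloorEdge a) (v : Fin a) :
    (ofEdges E).div v = netFlow (fun e => (E e).src) (fun e => (E e).tgt)
      (fun e => ((E e).weight : ℕ)) v := by
  rw [div, netFlow_apply, ofEdges, Multiset.filter_map, Multiset.map_map, Multiset.filter_map,
    Multiset.map_map]
  simp only [mul_sub, Finset.sum_sub_distrib, mul_ite, mul_one, mul_zero, ← Finset.sum_filter]
  rfl

theorem graph_ofEdges (E : Fin m → FloorEdge a) :
    (ofEdges E).graph = edgeGraph (fun e => (E e).src) (fun e => (E e).tgt) Finset.univ := by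
  rw [graph, edgeGraph]
  congr 1
  funext u v
  simp [ofEdges]

/-- The combinatorial types of marked floor diagrams with `m` labelled edges: the endpoints of the
edges and the white vertices to which the ends are attached. -/
abbrev CombType (a m lr ll : ℕ) : Type :=
  {st : (Fin m → Fin a) × (Fin m → Fin a) // ∀ e, st.1 e < st.2 e} ×
    ((Fin lr → Fin a) × (Fin ll → Fin a))

namespace CombType

/-- The number of total orders on the vertices of the marked diagrams of type `C`. -/
noncomputable def numOrders (C : CombType a m lr ll) : ℕ :=
  Nat.card {r // IsMarkedOrder C.1.1.1 C.1.1.2 C.2 r}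

/-- The edge weights of the marked diagrams of type `C` with end weights `w`. -/
abbrev Weights (C : CombType a m lr ll) (k : ℕ) (w : EndWeights lr ll) : Type :=
  {y : Fin m → ℕ+ // netFlow C.1.1.1 C.1.1.2 (fun e => ((y e : ℕ) : ℤ)) = requiredInflow k C.2 w}

/-- The edges of the floor diagrams of type `C`. -/
def edges (C : CombType a m lr ll) (y : Fin m → ℕ+) : Fin m → FloorEdge a :=
  fun e => ⟨C.1.1.1 e, C.1.1.2 e, C.1.2 e, y e⟩

instance (C : CombType a m lr ll) (w : EndWeights lr ll) : Finite (C.Weights k w) := by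
  have := (finite_flowFiber C.1.2 Finset.univ 1 (requiredInflow k C.2 w)).to_subtype
  refine Finite.of_injective (β := flowFiber C.1.1.1 C.1.1.2 Finset.univ 1 (requiredInflow k C.2 w))
    (fun y => ⟨fun e => ((y.1 e : ℕ) : ℤ), fun e _ => ?_, by simp, y.2⟩) fun y y' h => ?_
  · have := (y.1 e).pos
    simp only [Pi.one_apply]
    omega
  · ext e
    have := congrFun (congrArg Subtype.val h) e
    simpa using this

end CombType

/-- Marked floor diagrams with labelled edges are classified by their combinatorial type, the
weights of the edges, and the total order of the vertices. -/
theorem exists_equiv_combType (a m k : ℕ) {lr ll : ℕ} (w : EndWeights lr ll) :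
    ∃ Φ : (Σ E : Fin m → FloorEdge a, (ofEdges E).Marking k w) ≃
      Σ C : CombType a m lr ll, C.Weights k w × {r // IsMarkedOrder C.1.1.1 C.1.1.2 C.2 r},
      ∀ x, (Φ x).1.edges (Φ x).2.1.1 = x.1 := by
  choose β hβ using fun E : Fin m → FloorEdge a => exists_labelling_of_map_eq (E := E) rfl
  let Φ₁ := Equiv.sigmaCongrRight fun E : Fin m → FloorEdge a =>
    markingEquiv (k := k) (w := w) (β E) (fun e => congrArg FloorEdge.src (hβ E e))
      (fun e => congrArg FloorEdge.tgt (hβ E e))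
  let Φ₂ : (Σ E : Fin m → FloorEdge a, Σ p : {p : (Fin lr → Fin a) × (Fin ll → Fin a) //
      ∀ v, (ofEdges E).div v = requiredInflow k p w v},
        {r // IsMarkedOrder (fun e => (E e).src) (fun e => (E e).tgt) p.1 r}) ≃
      Σ C : CombType a m lr ll, C.Weights k w × {r // IsMarkedOrder C.1.1.1 C.1.1.2 C.2 r} :=
    { toFun := fun x => ⟨(⟨(fun e => (x.1 e).src, fun e => (x.1 e).tgt),
          fun e => (x.1 e).src_lt_tgt⟩, x.2.1.1),
        ⟨fun e => (x.1 e).weight, funext fun v => by rw [← x.2.1.2 v, div_ofEdges]⟩, x.2.2⟩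
      invFun := fun x => ⟨x.1.edges x.2.1.1, ⟨x.1.2, fun v => by
        rw [div_ofEdges]
        exact congrFun x.2.1.2 v⟩, x.2.2⟩
      left_inv := fun x => rfl
      right_inv := fun x => rfl }
  exact ⟨Φ₁.trans Φ₂, fun x => rfl⟩

end FloorDiagram

/-! ### The count as a sum over combinatorial types -/

namespace FloorDiagram

variable {a m lr ll k : ℕ}

instance (w : EndWeights lr ll) : Finite (Σ E : Fin m → FloorEdge a, (ofEdges E).Marking k w) := by
  obtain ⟨Φ, -⟩ := exists_equiv_combType a m k w
  exact Finite.of_equiv _ Φ.symm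

noncomputable instance (C : CombType a m lr ll) (w : EndWeights lr ll) :
    Fintype (C.Weights k w) := Fintype.ofFinite _

/-- The number of permutations of the ends which preserve their weights. -/
noncomputable def numEndPerms (w : EndWeights lr ll) : ℕ :=
  Nat.card {π : Equiv.Perm (Fin lr) // ∀ j, w (Sum.inl (π j)) = w (Sum.inl j)} *
    Nat.card {π : Equiv.Perm (Fin ll) // ∀ i, w (Sum.inr (π i)) = w (Sum.inr i)}

theorem numEndPerms_ne_zero (w : EndWeights lr ll) : numEndPerms w ≠ 0 := by
  have h1 : Nonempty {π : Equiv.Perm (Fin lr) // ∀ j, w (Sum.inl (π j)) = w (Sum.inl j)} :=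
    ⟨⟨1, fun _ => rfl⟩⟩
  have h2 : Nonempty {π : Equiv.Perm (Fin ll) // ∀ i, w (Sum.inr (π i)) = w (Sum.inr i)} :=
    ⟨⟨1, fun _ => rfl⟩⟩
  exact mul_ne_zero Nat.card_pos.ne' Nat.card_pos.ne'

/-- Permutations of identical edges multiply the number of markings and divide the number of
labellings, so they cancel. The remaining factor depends on `w` but not on `D`. -/
theorem card_labelled_markings {D : FloorDiagram a} (hD : Multiset.card D.edges = m)
    (w : EndWeights lr ll) :
    Nat.card {x : Σ E : Fin m → FloorEdge a, (ofEdges E).Marking k w // ofEdges x.1 = D} =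
      m.factorial * numEndPerms w * D.numMarkings k w := by
  let e₁ : {x : Σ E : Fin m → FloorEdge a, (ofEdges E).Marking k w // ofEdges x.1 = D} ≃
      Σ E : {E : Fin m → FloorEdge a // ofEdges E = D}, (ofEdges E.1).Marking k w :=
    { toFun := fun x => ⟨⟨x.1.1, x.2⟩, x.1.2⟩
      invFun := fun x => ⟨⟨x.1.1, x.2⟩, x.1.2⟩
      left_inv := fun _ => rfl
      right_inv := fun _ => rfl }
  let e₂ : (Σ E : {E : Fin m → FloorEdge a // ofEdges E = D}, (ofEdges E.1).Marking k w) ≃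
      Σ _ : {E : Fin m → FloorEdge a // ofEdges E = D}, D.Marking k w :=
    Equiv.sigmaCongrRight fun E => Equiv.cast (by rw [E.2])
  rw [Nat.card_congr (e₁.trans (e₂.trans (Equiv.sigmaEquivProd _ _))), Nat.card_prod, card_marking,
    Nat.card_prod, Nat.card_prod, ← card_labellings hD, numEndPerms]
  ring

theorem exists_ofEdges_eq {D : FloorDiagram a} (hD : Multiset.card D.edges = m) :
    ∃ E : Fin m → FloorEdge a, ofEdges E = D :=
  ⟨_, ofEdges_of_labelling (Fintype.equivOfCardEq (by simp [hD]) : Fin m ≃ D.edges.ToType)⟩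

variable (a m k) in
theorem finite_setOf_numMarkings_ne_zero (w : EndWeights lr ll) :
    {D : FloorDiagram a | Multiset.card D.edges = m ∧ D.numMarkings k w ≠ 0}.Finite := by
  refine (Set.finite_range fun x : Σ E : Fin m → FloorEdge a, (ofEdges E).Marking k w =>
    ofEdges x.1).subset ?_
  rintro D ⟨hD, hν⟩
  obtain ⟨E, rfl⟩ := exists_ofEdges_eq hD
  obtain ⟨⟨q⟩⟩ := (Nat.card_ne_zero.1 hν).1
  exact ⟨⟨E, q⟩, rfl⟩

/-- Counting labelled marked floor diagrams in two ways. -/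
theorem sum_combType (w : EndWeights lr ll) (f : FloorDiagram a → ℚ) :
    ∑ C : CombType a m lr ll, (C.numOrders : ℚ) *
      ∑ y : C.Weights k w, f (ofEdges (C.edges y.1)) =
    m.factorial * numEndPerms w *
      ∑ D ∈ (finite_setOf_numMarkings_ne_zero a m k w).toFinset, D.numMarkings k w * f D := by
  classical
  obtain ⟨Φ, hΦ⟩ := exists_equiv_combType a m k w
  let : Fintype (Σ E : Fin m → FloorEdge a, (ofEdges E).Marking k w) := Fintype.ofFinite _
  let : ∀ C : CombType a m lr ll, Fintype {r // IsMarkedOrder C.1.1.1 C.1.1.2 C.2 r} :=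
    fun _ => Fintype.ofFinite _
  have h1 : ∑ x : Σ E : Fin m → FloorEdge a, (ofEdges E).Marking k w, f (ofEdges x.1) =
      ∑ C : CombType a m lr ll, (C.numOrders : ℚ) *
        ∑ y : C.Weights k w, f (ofEdges (C.edges y.1)) := by
    calc _ = ∑ x, f (ofEdges ((Φ x).1.edges (Φ x).2.1.1)) :=
          Finset.sum_congr rfl fun x _ => by rw [hΦ]
      _ = ∑ z : Σ C : CombType a m lr ll, C.Weights k w ×
            {r // IsMarkedOrder C.1.1.1 C.1.1.2 C.2 r}, f (ofEdges (z.1.edges z.2.1.1)) :=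
          Equiv.sum_comp Φ fun z => f (ofEdges (z.1.edges z.2.1.1))
      _ = _ := by
          rw [Fintype.sum_sigma]
          refine Finset.sum_congr rfl fun C _ => ?_
          rw [Fintype.sum_prod_type, Finset.mul_sum]
          refine Finset.sum_congr rfl fun y _ => ?_
          dsimp only
          rw [Finset.sum_const, Finset.card_univ, nsmul_eq_mul, CombType.numOrders,
            Nat.card_eq_fintype_card]
  rw [← h1, Finset.sum_comp, Finset.mul_sum]
  have hsub : Finset.univ.image (fun x : Σ E : Fin m → FloorEdge a, (ofEdges E).Marking k w =>
      ofEdges x.1) ⊆ (finite_setOf_numMarkings_ne_zero a m k w).toFinset := by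
    intro D hD
    obtain ⟨x, -, rfl⟩ := Finset.mem_image.1 hD
    have hne : Nonempty {z : Σ E : Fin m → FloorEdge a, (ofEdges E).Marking k w //
        ofEdges z.1 = ofEdges x.1} := ⟨⟨x, rfl⟩⟩
    have hcard : Multiset.card (ofEdges x.1).edges = m := by simp [ofEdges]
    have := card_labelled_markings (k := k) hcard w
    rw [Set.Finite.mem_toFinset]
    refine ⟨hcard, fun h0 => ?_⟩
    rw [h0, mul_zero] at this
    exact Nat.card_pos.ne' this
  have hfib : ∀ D : FloorDiagram a, Multiset.card D.edges = m →
      (Finset.univ.filter fun x : Σ E : Fin m → FloorEdge a, (ofEdges E).Marking k w =>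
        ofEdges x.1 = D).card = m.factorial * numEndPerms w * D.numMarkings k w := by
    intro D hD
    rw [← card_labelled_markings hD w, Nat.card_eq_fintype_card, Fintype.card_subtype]
  rw [Finset.sum_subset hsub]
  · refine Finset.sum_congr rfl fun D hD => ?_
    rw [hfib D ((Set.Finite.mem_toFinset _).1 hD).1, nsmul_eq_mul]
    push_cast
    ring
  · intro D _ hD
    rw [Finset.card_eq_zero.2, zero_smul]
    refine Finset.filter_eq_empty_iff.2 fun x _ hx => hD ?_
    exact Finset.mem_image.2 ⟨x, Finset.mem_univ x, hx⟩

theorem IsAdmissible.card_edges {D : FloorDiagram a} {g : ℕ} {c : WithTop ℤ}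
    (h : D.IsAdmissible g c) (hm : m + 1 = g + a) : Multiset.card D.edges = m := by
  have := h.2.1
  rw [genus] at this
  omega

/-- Admissibility does not depend on the edge weights `y`: connectedness belongs to the type, and
the divergences are the inflow forced by the ends. It can therefore be pulled out of the sum over
`y`. -/
theorem isAdmissible_ofEdges {C : CombType a m lr ll} {g : ℕ} (hm : m + 1 = g + a)
    {c : WithTop ℤ} {w : EndWeights lr ll} (y : C.Weights k w) :
    (ofEdges (C.edges y.1)).IsAdmissible g c ↔
      (edgeGraph C.1.1.1 C.1.1.2 Finset.univ).Connected ∧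
        ∀ v, (requiredInflow k C.2 w v : WithTop ℤ) ≤ c := by
  have hgenus : (ofEdges (C.edges y.1)).genus = g := by
    simp only [genus, ofEdges, Multiset.card_map, Finset.card_val, Finset.card_univ,
      Fintype.card_fin]
    omega
  have hdiv : ∀ v, (ofEdges (C.edges y.1)).div v = requiredInflow k C.2 w v := fun v => by
    rw [div_ofEdges]
    exact congrFun y.2 v
  simp only [IsAdmissible, graph_ofEdges, hgenus, hdiv, true_and]
  rfl

open Classical in
/-- The sum over the admissible floor diagrams that have a marking, expressed through labelled
floor diagrams. -/
theorem sum_isAdmissible {g : ℕ} (hm : m + 1 = g + a) (c : WithTop ℤ) (w : EndWeights lr ll)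
    (f : FloorDiagram a → ℚ) :
    ∑ D ∈ (finite_setOf_numMarkings_ne_zero a m k w).toFinset with D.IsAdmissible g c,
      D.numMarkings k w * f D =
    ((m.factorial : ℚ)⁻¹ * (numEndPerms w : ℚ)⁻¹) * ∑ C : CombType a m lr ll, (C.numOrders : ℚ) *
      ((if (edgeGraph C.1.1.1 C.1.1.2 Finset.univ).Connected then 1 else 0) *
        ((if ∀ v, (requiredInflow k C.2 w v : WithTop ℤ) ≤ c then 1 else 0) *
          ∑ y : C.Weights k w, f (ofEdges (C.edges y.1)))) := by
  have key := sum_combType (m := m) (k := k) w fun D => if D.IsAdmissible g c then f D else 0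
  have h1 : ∀ C : CombType a m lr ll, ∑ y : C.Weights k w,
      (if (ofEdges (C.edges y.1)).IsAdmissible g c then f (ofEdges (C.edges y.1)) else 0) =
      (if (edgeGraph C.1.1.1 C.1.1.2 Finset.univ).Connected then 1 else 0) *
        ((if ∀ v, (requiredInflow k C.2 w v : WithTop ℤ) ≤ c then 1 else 0) *
          ∑ y : C.Weights k w, f (ofEdges (C.edges y.1))) := by
    intro C
    rw [Finset.mul_sum, Finset.mul_sum]
    refine Finset.sum_congr rfl fun y _ => ?_
    simp only [isAdmissible_ofEdges hm y]
    split_ifs <;> simp_all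
  simp only [h1] at key
  rw [key]
  have hm0 : (m.factorial : ℚ) ≠ 0 := by exact_mod_cast m.factorial_ne_zero
  have hw0 : (numEndPerms w : ℚ) ≠ 0 := by exact_mod_cast numEndPerms_ne_zero w
  rw [Finset.sum_filter]
  simp only [mul_ite, mul_zero]
  field_simp

theorem isAffineOn_requiredInflow {S : Set (EndWeights lr ll)}
    (p : (Fin lr → Fin a) × (Fin ll → Fin a)) (v : Fin a) :
    IsAffineOn S fun w => (requiredInflow k p w v : ℚ) := by
  simp only [requiredInflow]
  push_cast
  exact .add (.sub (.const _) (.sum _ fun i _ => .coord _)) (.sum _ fun j _ => .coord _)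

/-- Which permutations preserve the end weights depends only on which weights coincide, so dividing
by their number does no harm. -/
theorem isPiecewisePoly_inv_numEndPerms {S : Set (EndWeights lr ll)} :
    IsPiecewisePoly S fun w => (numEndPerms w : ℚ)⁻¹ :=
  IsPiecewisePoly.of_coincidences fun R : Fin lr ⊕ Fin ll → Fin lr ⊕ Fin ll → Prop =>
    ((Nat.card {π : Equiv.Perm (Fin lr) // ∀ j, R (Sum.inl (π j)) (Sum.inl j)} *
      Nat.card {π : Equiv.Perm (Fin ll) // ∀ i, R (Sum.inr (π i)) (Sum.inr i)} : ℕ) : ℚ)⁻¹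

open Classical in
theorem isPiecewisePoly_sum_isAdmissible {S : Set (EndWeights lr ll)} {g : ℕ} (hm : m + 1 = g + a)
    {c : WithTop ℤ} (hc : c = ((k : ℤ) : WithTop ℤ) ∨ c = ⊤)
    {F : EndWeights lr ll → FloorDiagram a → ℚ}
    (hF : ∀ C : CombType a m lr ll, IsPiecewisePoly S fun w =>
      ∑ y : C.Weights k w, F w (ofEdges (C.edges y.1))) :
    IsPiecewisePoly S fun w => ∑ D ∈ (finite_setOf_numMarkings_ne_zero a m k w).toFinset with
      D.IsAdmissible g c, D.numMarkings k w * F w D := by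
  simp only [sum_isAdmissible hm]
  refine .mul (.mul (.const _) isPiecewisePoly_inv_numEndPerms) (.sum _ fun C _ =>
    .mul (.const _) (.mul (.const _) (.mul ?_ (hF C))))
  -- The bound `k` on the divergences is a sign condition on affine forms in `w`; the bound `⊤` is
  -- no condition.
  rcases hc with rfl | rfl
  · refine (IsPiecewisePoly.indicator_forall Finset.univ fun v _ => .indicator_nonneg (.sub
      (.const (k : ℚ)) (isAffineOn_requiredInflow (k := k) C.2 v))).congr fun w _ => ?_
    refine if_congr ?_ rfl rfl
    simp only [WithTop.coe_le_coe, Finset.mem_univ, true_implies, sub_nonneg]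
    refine forall_congr' fun v => ?_
    exact_mod_cast Iff.rfl
  · simpa using IsPiecewisePoly.const 1

/-- Positive weights are integral flows with lower bound `1` and all edges free. -/
theorem sum_weights (C : CombType a m lr ll) (w : EndWeights lr ll) (G : (Fin m → ℤ) → ℚ) :
    ∑ y : C.Weights k w, G (fun e => ((y.1 e : ℕ) : ℤ)) =
      ∑ x ∈ (finite_flowFiber C.1.2 Finset.univ 1 (requiredInflow k C.2 w)).toFinset, G x := by
  refine Finset.sum_bij (fun y _ e => ((y.1 e : ℕ) : ℤ)) (fun y _ => ?_) (fun y _ y' _ h => ?_)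
    (fun x hx => ?_) fun _ _ => rfl
  · refine (Set.Finite.mem_toFinset _).2 ⟨fun e _ => ?_, by simp, y.2⟩
    have := (y.1 e).pos
    simp only [Pi.one_apply]
    omega
  · ext e
    simpa using congrFun h e
  · obtain ⟨h1, -, h3⟩ := (Set.Finite.mem_toFinset _).1 hx
    have hpos : ∀ e, 0 < (x e).toNat := fun e => by
      have := h1 e (Finset.mem_univ e)
      simp only [Pi.one_apply] at this
      omega
    let y : Fin m → ℕ+ := fun e => Nat.toPNat (x e).toNat (hpos e)
    have hx' : (fun e => ((y e : ℕ) : ℤ)) = x := funext fun e => by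
      have h : ((y e : ℕ) : ℤ) = ((x e).toNat : ℤ) := rfl
      have := hpos e
      omega
    exact ⟨⟨y, by rw [hx', h3]⟩, Finset.mem_univ _, hx'⟩

theorem isPiecewisePoly_sum_prod_markedWeights {S : Set (EndWeights lr ll)}
    (C : CombType a m lr ll) : IsPiecewisePoly S fun w => ∑ y : C.Weights k w,
      ((((ofEdges (C.edges y.1)).markedWeights w).prod : ℕ+) : ℚ) := by
  have h : ∀ w (y : C.Weights k w), ((((ofEdges (C.edges y.1)).markedWeights w).prod : ℕ+) : ℚ) =
      (∏ x, ((w x : ℕ) : ℚ)) * MvPolynomial.eval (fun e => (((y.1 e : ℕ) : ℤ) : ℚ))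
        (∏ e, MvPolynomial.X e ^ 2) := by
    intro w y
    have : ((ofEdges (C.edges y.1)).edges.map fun e => e.weight).prod = ∏ e, y.1 e := by
      rw [ofEdges, Multiset.map_map]
      rfl
    rw [prod_markedWeights, this]
    simp [Finset.prod_pow, mul_comm]
  simp only [h, ← Finset.mul_sum]
  refine .mul (.prod _ fun x _ => .of_isAffineOn (.coord x)) ?_
  refine (isPiecewisePoly_sum_flowFiber C.1.2 Finset.univ 1
    (isAffineOn_requiredInflow (k := k) C.2) (∏ e, MvPolynomial.X e ^ 2)).congr fun w _ => ?_
  exact sum_weights C w fun x => MvPolynomial.eval (fun e => (x e : ℚ)) (∏ e, MvPolynomial.X e ^ 2)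

-- Odd positive flows are $y=2x+1$ with $x\ge 0$, and the inflow of $x$ is half of an affine
-- expression in `w`. As all end weights are odd, the parity of that expression is constant on `S`:
-- either it is always divisible by two, or there are no odd flows at all.
open Classical in
theorem isPiecewisePoly_sum_isOdd {S : Set (EndWeights lr ll)}
    (hS : ∀ w ∈ S, ∀ x, Odd (w x : ℕ)) (C : CombType a m lr ll) :
    IsPiecewisePoly S fun w => ∑ y : C.Weights k w,
      if (ofEdges (C.edges y.1)).IsOdd then (1 : ℚ) else 0 := by
  -- The parity is computed at the reference point where all ends and all edges have weight one.
  let p : Fin a → ℤ := fun v => requiredInflow k C.2 1 v - netFlow C.1.1.1 C.1.1.2 1 v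
  have hp : ∀ w ∈ S, ∀ v, 2 ∣ requiredInflow k C.2 w v - requiredInflow k C.2 1 v := by
    intro w hw v
    have hdvd : ∀ x, (2 : ℤ) ∣ ((w x : ℕ) : ℤ) - (((1 : EndWeights lr ll) x : ℕ) : ℤ) := by
      intro x
      obtain ⟨t, ht⟩ := hS w hw x
      exact ⟨t, by simp [ht]⟩
    have : requiredInflow k C.2 w v - requiredInflow k C.2 1 v =
        ∑ j with C.2.1 j = v,
          (((w (Sum.inl j) : ℕ) : ℤ) - (((1 : EndWeights lr ll) (Sum.inl j) : ℕ) : ℤ)) -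
        ∑ i with C.2.2 i = v,
          (((w (Sum.inr i) : ℕ) : ℤ) - (((1 : EndWeights lr ll) (Sum.inr i) : ℕ) : ℤ)) := by
      simp only [requiredInflow, Finset.sum_sub_distrib]
      ring
    rw [this]
    exact dvd_sub (Finset.dvd_sum fun j _ => hdvd _) (Finset.dvd_sum fun i _ => hdvd _)
  have hodd : ∀ w (y : C.Weights k w), (ofEdges (C.edges y.1)).IsOdd ↔
      ∀ e, Odd (((y.1 e : ℕ) : ℤ)) := by
    intro w y
    simp [IsOdd, ofEdges, CombType.edges]
  simp only [hodd]
  have hsum : ∀ w, (∑ y : C.Weights k w, if ∀ e, Odd (((y.1 e : ℕ) : ℤ)) then (1 : ℚ) else 0) = _ :=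
    fun w => sum_weights C w fun x => if ∀ e, Odd (x e) then 1 else 0
  simp only [hsum]
  have hflow : ∀ x : Fin m → ℤ, netFlow C.1.1.1 C.1.1.2 (fun e => 2 * x e + 1) =
      fun v => 2 * netFlow C.1.1.1 C.1.1.2 x v + netFlow C.1.1.1 C.1.1.2 1 v := by
    intro x
    have : (fun e => 2 * x e + 1) = x + x + 1 := by
      ext e
      simp [two_mul]
    rw [this, map_add, map_add]
    ext v
    simp [two_mul]
  by_cases hpar : ∀ v, 2 ∣ p v
  · let d : EndWeights lr ll → Fin a → ℤ := fun w v =>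
      (requiredInflow k C.2 w v - netFlow C.1.1.1 C.1.1.2 1 v) / 2
    have hd : ∀ w ∈ S, ∀ v, 2 * d w v = requiredInflow k C.2 w v - netFlow C.1.1.1 C.1.1.2 1 v := by
      intro w hw v
      refine Int.mul_ediv_cancel' ?_
      have := dvd_add (hp w hw v) (hpar v)
      simpa [p] using this
    have hd' : ∀ v, IsAffineOn S fun w => (d w v : ℚ) := by
      intro v
      refine (((isAffineOn_requiredInflow (k := k) C.2 v).sub
        (.const (netFlow C.1.1.1 C.1.1.2 1 v : ℚ))).const_mul (1 / 2)).congr fun w hw => ?_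
      have : (2 : ℚ) * d w v = requiredInflow k C.2 w v - netFlow C.1.1.1 C.1.1.2 1 v := by
        exact_mod_cast hd w hw v
      linarith
    -- The lower bound is `0` because $2x+1\ge 1$ means $x\ge 0$; the summand is the constant
    -- polynomial `1`.
    refine (isPiecewisePoly_sum_flowFiber C.1.2 Finset.univ 0 hd' 1).congr fun w hw => ?_
    rw [← Finset.sum_filter]
    simp only [map_one]
    symm
    refine Finset.sum_bij (fun x _ e => 2 * x e + 1) (fun x hx => ?_) (fun x _ x' _ h => ?_)
      (fun z hz => ?_) fun _ _ => rfl
    · obtain ⟨h1, -, h3⟩ := (Set.Finite.mem_toFinset _).1 hx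
      refine Finset.mem_filter.2 ⟨(Set.Finite.mem_toFinset _).2 ⟨fun e he => ?_, by simp, ?_⟩,
        fun e => ⟨x e, rfl⟩⟩
      · have := h1 e he
        simp only [Pi.zero_apply, Pi.one_apply] at this ⊢
        omega
      · rw [hflow, h3]
        ext v
        rw [hd w hw v]
        ring
    · ext e
      have := congrFun h e
      omega
    · obtain ⟨hz1, hz2⟩ := Finset.mem_filter.1 hz
      obtain ⟨h1, -, h3⟩ := (Set.Finite.mem_toFinset _).1 hz1
      choose x hx using hz2
      obtain rfl : z = fun e => 2 * x e + 1 := funext hx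
      refine ⟨x, (Set.Finite.mem_toFinset _).2 ⟨fun e he => ?_, by simp, ?_⟩, rfl⟩
      · have := h1 e he
        simp only [Pi.zero_apply, Pi.one_apply] at this ⊢
        omega
      · rw [hflow] at h3
        ext v
        have h4 := congrFun h3 v
        have h5 := hd w hw v
        omega
  · refine (IsPiecewisePoly.const 0).congr fun w hw => Finset.sum_eq_zero fun z hz => if_neg ?_
    intro hz2
    obtain ⟨-, -, h3⟩ := (Set.Finite.mem_toFinset _).1 hz
    choose x hx using hz2
    obtain rfl : z = fun e => 2 * x e + 1 := funext hx
    refine hpar fun v => ?_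
    rw [hflow] at h3
    have h4 := congrFun h3 v
    have h5 := hp w hw v
    simp only [p]
    omega

-- The genus fixes the number of edges of an admissible diagram, and among diagrams with that many
-- edges only finitely many have a marking.
open Classical in
theorem finsum_numMarkings_smul {A : Type*} [AddCommGroup A] {g : ℕ} (hm : m + 1 = g + a)
    (c : WithTop ℤ) (w : EndWeights lr ll) {P : FloorDiagram a → Prop}
    (hP : ∀ D, P D → D.IsAdmissible g c) (f : FloorDiagram a → A) :
    ∑ᶠ (D : FloorDiagram a) (_ : P D), D.numMarkings k w • f D =
      ∑ D ∈ (finite_setOf_numMarkings_ne_zero a m k w).toFinset with P D,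
        D.numMarkings k w • f D := by
  refine finsum_cond_eq_sum_of_cond_iff _ fun {D} hD => ?_
  rw [Finset.mem_filter, Set.Finite.mem_toFinset]
  refine ⟨fun h => ⟨⟨(hP D h).card_edges hm, fun h0 => hD ?_⟩, h⟩, fun h => h.2⟩
  rw [h0, zero_smul]

end FloorDiagram

/-! ### The theorem -/

open FloorDiagram

theorem theorem5p7 {K : Type u} [Field K] [CharZero K] (k a g lr ll : ℕ)
    (ha : 1 ≤ a) (hr : 1 ≤ lr) (hl : 1 ≤ ll)
    -- the divergences of floor diagrams are bounded by `k`, or not bounded at all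
    (c : WithTop ℤ) (hc : c = ((k : ℤ) : WithTop ℤ) ∨ c = ⊤) :
    ∃ M : EndWeights lr ll → ℤ,
      (∀ w ∈ oddEndWeights k a lr ll, ∃ i : FloorDiagram a → ℕ,
        floorCount K k a g c w = M w • GW.hyperbolic K +
          ∑ᶠ (D : FloorDiagram a) (_ : D.IsAdmissible g c ∧ D.IsOdd), D.numMarkings k w •
            GW.unitForm ((-1) ^ i D * (∏ j, natUnit K (w (Sum.inl j))) *
              (∏ j, natUnit K (w (Sum.inr j))))) ∧
      IsPiecewisePolynomialOn (oddEndWeights k a lr ll) M := by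
  classical
  -- A connected graph on `a` vertices with first Betti number `g` has $g+a-1$ edges.
  obtain ⟨m, hm⟩ : ∃ m, m + 1 = g + a := ⟨g + a - 1, by omega⟩
  let T : EndWeights lr ll → Finset (FloorDiagram a) := fun w =>
    (finite_setOf_numMarkings_ne_zero a m k w).toFinset
  refine ⟨fun w => ∑ D ∈ T w with D.IsAdmissible g c, D.numMarkings k w * D.hyperbolicCoeff w,
    -- No signs are needed: the discriminants in `mult_eq` agree with the product of the end weights
    -- up to squares.
    fun w hw => ⟨0, ?_⟩, ?_⟩
  · rw [floorCount, finsum_numMarkings_smul hm c w (fun _ h => h),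
      finsum_numMarkings_smul hm c w (fun _ h => h.1)]
    simp only [Pi.zero_apply, pow_zero, one_mul, mult_eq K _ w hw.1, smul_add,
      Finset.sum_add_distrib]
    congr 1
    · rw [Finset.sum_smul]
      refine Finset.sum_congr rfl fun D _ => ?_
      rw [mul_smul, natCast_zsmul]
    · rw [Finset.sum_filter, Finset.sum_filter]
      refine Finset.sum_congr rfl fun D _ => ?_
      by_cases h₁ : D.IsAdmissible g c <;> by_cases h₂ : D.IsOdd <;> simp [h₁, h₂]
  · refine IsPiecewisePoly.isPiecewisePolynomialOn ?_
    -- By `two_mul_hyperbolicCoeff`, `M` is half the difference between the sum weighted by products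
    -- of weights and the count of odd diagrams; both are piecewise polynomial.
    refine (IsPiecewisePoly.mul (.const (1 / 2)) (.sub
      (isPiecewisePoly_sum_isAdmissible (k := k) hm hc
        (F := fun w D => (((D.markedWeights w).prod : ℕ+) : ℚ))
        isPiecewisePoly_sum_prod_markedWeights)
      (isPiecewisePoly_sum_isAdmissible (k := k) hm hc
        (F := fun _ D => if D.IsOdd then 1 else 0)
        (isPiecewisePoly_sum_isOdd fun w (hw : w ∈ oddEndWeights k a lr ll) => hw.1)))).congr
          fun w hw => ?_
    rw [← Finset.sum_sub_distrib, Finset.mul_sum]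
    push_cast
    refine Finset.sum_congr rfl fun D _ => ?_
    have h2 : (2 : ℚ) * D.hyperbolicCoeff w =
        (((D.markedWeights w).prod : ℕ+) : ℚ) - if D.IsOdd then 1 else 0 := by
      have := congrArg (Int.cast : ℤ → ℚ) (D.two_mul_hyperbolicCoeff w hw.1)
      push_cast at this
      exact this
    rw [← mul_sub, ← h2]
    ring
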